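/- Fix $u>0$. Let $f\in C_c^\infty(\mathbb R^3)$ (complex valued) and write $\vec\alpha=(\cos\alpha,\sin\alpha)$. For $\mu\in\mathbb R^2$ and $p,x_3,r\in\mathbb R$ with $r\ge 0$ put $$R_Tf(\mu,p,r)=\frac1{2\pi}\int_0^{2\pi}\!\int_0^{2\pi} f\big(\mu+(u-r\cos\beta)\vec\alpha,\;p+r\sin\beta\big)\,d\beta\,d\alpha ,\qquad Mf(\mu,x_3,r)=\int_0^{2\pi} f(\mu+r\vec\alpha,x_3)\,d\alpha .$$ For a function $g(\mu,p,r)$ let $$R_T^*g(\mu,z,\rho)=\int_{\mathbb R} g\big(\mu,p,\sqrt{(z-p)^2+\rho^2}\big)\,dp ,$$ and let $I_2^{-1}$ be the Fourier multiplier $\widehat{I_2^{-1}h}(\mu,\xi)=|\xi_2|\,\hat h(\mu,\xi)$, where $\hat h(\mu,\xi)=\int_{\mathbb R^2}h(\mu,z,\rho)e^{-i(z\xi_1+\rho\xi_2)}\,dz\,d\rho$, so that $I_2^{-1}h(\mu,z,\rho)=\frac1{4\pi^2}\int_{\mathbb R^2}|\xi_2|\hat h(\mu,\xi)e^{i(z\xi_1+\rho\xi_2)}d\xi$.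 For $a,b\in\mathbb R$ let $\chi_{a,b}\,g(\mu,p,r)=g(\mu,p,r)$ if $-a\le p\le b$ and $0$ otherwise. Then for every $\mu\in\mathbb R^2$: 1. For all $a,b$, every integral occurring in $I_2^{-1}R_T^*(\chi_{a,b}R_Tf)(\mu,\cdot,\cdot)$ converges absolutely: the back-projection integral at every $(z,\rho)$, the Fourier integral of $R_T^*(\chi_{a,b}R_Tf)(\mu,\cdot,\cdot)$, and the inverse Fourier integral of $|\xi_2|$ times that transform. 2. With the integral over $p\in\mathbb R$ in $R_T^*$ taken as an improper integral, $I_2^{-1}R_T^*R_Tf=Mf(\cdot,\cdot,|u-r|)+Mf(\cdot,\cdot,u+r)$; that is, for all $x_3\in\mathbb R$ and $r\ge0$, $$\lim_{a,b\to\infty} I_2^{-1}R_T^*\big(\chi_{a,b}R_Tf\big)(\mu,x_3,r)=Mf(\mu,x_3,|u-r|)+Mf(\mu,x_3,u+r),$$ where $a$ and $b$ tend to infinity independently. 3. If the integral defining $R_T^*R_Tf(\mu,z,\rho)$ converges absolutely for all $z,\rho\in\mathbb R$, then so do the Fourier integral of $R_T^*R_Tf(\mu,\cdot,\cdot)$ and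 the inverse Fourier integral of $|\xi_2|$ times that transform, and for all $x_3\in\mathbb R$ and $r\ge 0$ $$I_2^{-1}R_T^*R_Tf(\mu,x_3,r)=Mf(\mu,x_3,|u-r|)+Mf(\mu,x_3,u+r).$$ -/

import Mathlib

open MeasureTheory Filter Topology
open scoped ContDiff

noncomputable section

/-- The toroidal Radon transform, for tori parallel to the `x₁x₂`-plane whose central circle has
radius `u`:
`R_T f (μ, p, r) = (1 / 2π) ∫₀^{2π} ∫₀^{2π} f (μ + (u - r cos β) (cos α, sin α), p + r sin β) dβ dα`. -/
def toroidalRadon (u : ℝ) (f : EuclideanSpace ℝ (Fin 3) → ℂ)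
    (μ : EuclideanSpace ℝ (Fin 2)) (p r : ℝ) : ℂ :=
  (1 / (2 * (Real.pi : ℂ))) *
    ∫ α in (0 : ℝ)..(2 * Real.pi), ∫ β in (0 : ℝ)..(2 * Real.pi),
      f !₂[μ 0 + (u - r * Real.cos β) * Real.cos α,
           μ 1 + (u - r * Real.cos β) * Real.sin α,
           p + r * Real.sin β]

/-- The circular Radon transform
`M f (μ, x₃, r) = ∫₀^{2π} f (μ + r (cos α, sin α), x₃) dα`. -/
def circularRadon (f : EuclideanSpace ℝ (Fin 3) → ℂ)
    (μ : EuclideanSpace ℝ (Fin 2)) (x₃ r : ℝ) : ℂ :=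
  ∫ α in (0 : ℝ)..(2 * Real.pi),
    f !₂[μ 0 + r * Real.cos α, μ 1 + r * Real.sin α, x₃]

/-- The back-projection
`R_T^* g (μ, z, ρ) = ∫_ℝ g (μ, p, √((z - p)² + ρ²)) dp`. -/
def backProjection (g : EuclideanSpace ℝ (Fin 2) → ℝ → ℝ → ℂ)
    (μ : EuclideanSpace ℝ (Fin 2)) (z ρ : ℝ) : ℂ :=
  ∫ p : ℝ, g μ p (Real.sqrt ((z - p) ^ 2 + ρ ^ 2))

/-- The restriction of `g` to the heights `-a ≤ p ≤ b`, extended by zero. -/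
def truncateHeight (a b : ℝ) (g : EuclideanSpace ℝ (Fin 2) → ℝ → ℝ → ℂ)
    (μ : EuclideanSpace ℝ (Fin 2)) (p r : ℝ) : ℂ :=
  (Set.Icc (-a) b).indicator (fun q => g μ q r) p

/-- The Fourier transform in the last two variables,
`ĥ (μ, ξ) = ∫_{ℝ²} h (μ, z, ρ) e^{-i (z ξ₁ + ρ ξ₂)} d(z, ρ)`. -/
def fourierLastTwo (h : EuclideanSpace ℝ (Fin 2) → ℝ → ℝ → ℂ)
    (μ : EuclideanSpace ℝ (Fin 2)) (ξ : ℝ × ℝ) : ℂ :=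
  ∫ x : ℝ × ℝ, h μ x.1 x.2 * Complex.exp (-Complex.I * ((x.1 * ξ.1 + x.2 * ξ.2 : ℝ) : ℂ))

/-- The operator `I₂⁻¹`, the Fourier multiplier with symbol `|ξ₂|`: the inverse Fourier transform
of `|ξ₂| ĥ (μ, ξ)`. -/
def rieszTwoInv (h : EuclideanSpace ℝ (Fin 2) → ℝ → ℝ → ℂ)
    (μ : EuclideanSpace ℝ (Fin 2)) (z ρ : ℝ) : ℂ :=
  (1 / (4 * (Real.pi : ℂ) ^ 2)) *
    ∫ ξ : ℝ × ℝ, ((|ξ.2| : ℝ) : ℂ) * fourierLastTwo h μ ξ *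
      Complex.exp (Complex.I * ((z * ξ.1 + ρ * ξ.2 : ℝ) : ℂ))

/-- All integrals occurring in `I₂⁻¹ R_T^* g` at the base point `μ` converge absolutely: the
back-projection integral at every `(z, ρ)`, the integral defining the Fourier transform of
`R_T^* g`, and the inverse Fourier integral of `|ξ₂|` times that transform. -/
def FilteredBackProjectionConverges (g : EuclideanSpace ℝ (Fin 2) → ℝ → ℝ → ℂ)
    (μ : EuclideanSpace ℝ (Fin 2)) : Prop :=
  (∀ z ρ : ℝ, Integrable (fun p : ℝ => g μ p (Real.sqrt ((z - p) ^ 2 + ρ ^ 2)))) ∧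
  Integrable (fun x : ℝ × ℝ => backProjection g μ x.1 x.2) ∧
  Integrable (fun ξ : ℝ × ℝ =>
    ((|ξ.2| : ℝ) : ℂ) * fourierLastTwo (backProjection g) μ ξ)

end

/-! Fix `μ` and put H(z,t) = Mf(z,u-t) + Mf(z,u+t) (`toroidalSlice`). This is a test function in the
plane, even in t, and since M is even in the radius, H(x₃,r) is the right-hand side of the theorem.
Pairing β with π-β shows that R_T f(p,r) is half the mean of H over the circle with centre (p,0) and
radius r. Hence R_T^* integrates, over the centres p, half the mean of H over the circle centred at
(p,0) through the given point, and the theorem is an inversion formula for circular means centred on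
a line.

On the Fourier side a rotation about (p,0) becomes a rotation of the frequency together with a
phase. With R = |ξ| and the first coordinate s as parameter on the frequency circle, where dβ =
ds/√(R²-s²), evenness of Ĥ gives for centres in [-a,b] the transform (1/2π) ∫_{-a}^b ∫_{-R}^R
e^{ip(s-ξ₁)} Ĥ(s,√(R²-s²)) / √(R²-s²) ds dp (`planeFourier_axisBackProjection_eq_circleTransform`).
This is a truncated one-dimensional Fourier inversion at s = ξ₁, so it tends to Ĥ(ξ)/|ξ₂|, and the
multiplier |ξ₂| restores Ĥ.

To pass to the limit under the inverse transform, Dini's test is used quantitatively: it gives the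
limit and a bound free of a and b. The density is singular at s = ±R, and ξ₁ approaches these
endpoints as ξ₂ → 0. Sharing the singularity as (R²-s²)^{-3/4} in s and |ξ₂|^{-1/2} in frequency
keeps both integrable (`arcControlled_const_mul_arcDensity`, `CircleDecay.abs_mul_circleTransform`).
Dominated convergence and `planeFourier_inversion` finish the second claim; for the first, fixed a
and b preserve polynomial decay.

For the third claim, large circles through (z,0) flatten to a vertical line, so the mean with centre
z+q is asymptotically a multiple of q⁻¹ ∫ H(z,t) dt. Absolute convergence therefore forces these
line integrals to vanish, whence H = ∂_t²G with G a test function and Ĥ = ξ₂²e, e = -Ĝ. The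
transforms are now dominated even without the factor |ξ₂|, and the back-projection equals the
inverse transform of |ξ₂|e at every point. A hypersingular integral of G represents this function
and shows that it is integrable (`backProjection_axisMean_of_integrable`). -/

/-! ### Smooth dependence of integrals on parameters -/

/-- An integral over a compact interval depends smoothly on parameters. -/
theorem contDiff_nat_intervalIntegral_param {E : Type} [NormedAddCommGroup E] [NormedSpace ℝ E]
    [FiniteDimensional ℝ E] (a b : ℝ) (n : ℕ) :
    ∀ {F : Type} [NormedAddCommGroup F] [NormedSpace ℝ F] [CompleteSpace F] {f : E × ℝ → F},
      ContDiff ℝ ∞ f → ContDiff ℝ n (fun x => ∫ t in a..b, f (x, t)) := by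
  induction n with
  | zero =>
    intro F _ _ _ f hf
    have h : Continuous fun x => ∫ t in a..b, f (x, t) :=
      intervalIntegral.continuous_parametric_intervalIntegral_of_continuous'
        (f := fun x t => f (x, t)) hf.continuous a b
    simpa using h
  | succ n ih =>
    intro F _ _ _ f hf
    -- The derivative in the parameter takes values in `E →L[ℝ] F`, which is why the induction
    -- quantifies over the target space.
    set f' : E × ℝ → E →L[ℝ] F := fun y => (fderiv ℝ f y).comp (ContinuousLinearMap.inl ℝ E ℝ)
      with hf'
    have hf's : ContDiff ℝ ∞ f' :=
      (hf.fderiv_right (m := ∞) (by simp)).clm_comp contDiff_const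
    have hder : ∀ x t, HasFDerivAt (fun x => f (x, t)) (f' (x, t)) x := by
      intro x t
      have h1 : HasFDerivAt f (fderiv ℝ f (x, t)) (x, t) :=
        ((hf.differentiable (by simp)) (x, t)).hasFDerivAt
      exact HasFDerivAt.comp x h1 (hasFDerivAt_prodMk_left (𝕜 := ℝ) x t)
    have key : ∀ x, HasFDerivAt (fun x => ∫ t in a..b, f (x, t)) (∫ t in a..b, f' (x, t)) x := by
      intro x
      obtain ⟨C, hC⟩ := ((isCompact_closedBall x 1).prod
        (isCompact_uIcc (a := a) (b := b))).exists_bound_of_continuousOn hf's.continuous.continuousOn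
      refine intervalIntegral.hasFDerivAt_integral_of_dominated_of_fderiv_le (𝕜 := ℝ)
        (F := fun x t => f (x, t)) (F' := fun x t => f' (x, t)) (x₀ := x)
        (bound := fun _ => C) (Metric.closedBall_mem_nhds x one_pos) ?_ ?_ ?_ ?_ ?_ ?_
      · exact Eventually.of_forall fun y =>
          (hf.continuous.comp (by fun_prop : Continuous fun t : ℝ => (y, t))).aestronglyMeasurable
      · exact (hf.continuous.comp
          (by fun_prop : Continuous fun t : ℝ => (x, t))).intervalIntegrable _ _
      · exact (hf's.continuous.comp
          (by fun_prop : Continuous fun t : ℝ => (x, t))).aestronglyMeasurable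
      · exact Eventually.of_forall fun t ht y hy => hC (y, t) ⟨hy, Set.uIoc_subset_uIcc ht⟩
      · exact intervalIntegrable_const
      · exact Eventually.of_forall fun t _ y _ => hder y t
    push_cast
    rw [contDiff_succ_iff_fderiv]
    refine ⟨fun x => (key x).differentiableAt, by simp, ?_⟩
    have : fderiv ℝ (fun x => ∫ t in a..b, f (x, t)) = fun x => ∫ t in a..b, f' (x, t) :=
      funext fun x => (key x).fderiv
    rw [this]
    exact ih hf's

theorem contDiff_intervalIntegral_param {E F : Type} [NormedAddCommGroup E] [NormedSpace ℝ E]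
    [FiniteDimensional ℝ E] [NormedAddCommGroup F] [NormedSpace ℝ F] [CompleteSpace F] (a b : ℝ)
    {f : E × ℝ → F} (hf : ContDiff ℝ ∞ f) : ContDiff ℝ ∞ (fun x => ∫ t in a..b, f (x, t)) :=
  contDiff_infty.2 fun n => contDiff_nat_intervalIntegral_param a b n hf

/-! ### The Fourier transform in the plane: inversion and decay -/

noncomputable section

/-- The Fourier transform on `ℝ × ℝ` with kernel `e^{-i x·ξ}`. -/
def planeFourier (G : ℝ × ℝ → ℂ) (ξ : ℝ × ℝ) : ℂ :=
  ∫ x : ℝ × ℝ, G x * Complex.exp (-Complex.I * ((x.1 * ξ.1 + x.2 * ξ.2 : ℝ) : ℂ))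

end

theorem norm_exp_neg_I_mul_ofReal (x : ℝ) : ‖Complex.exp (-Complex.I * (x : ℂ))‖ = 1 := by
  rw [show -Complex.I * (x : ℂ) = ((-x : ℝ) : ℂ) * Complex.I by push_cast; ring,
    Complex.norm_exp_ofReal_mul_I]

theorem norm_exp_I_mul_ofReal (x : ℝ) : ‖Complex.exp (Complex.I * (x : ℂ))‖ = 1 := by
  rw [mul_comm, Complex.norm_exp_ofReal_mul_I]

theorem norm_planeFourier_le (G : ℝ × ℝ → ℂ) (ξ : ℝ × ℝ) :
    ‖planeFourier G ξ‖ ≤ ∫ x, ‖G x‖ := by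
  refine (norm_integral_le_integral_norm _).trans_eq ?_
  simp only [norm_mul, norm_exp_neg_I_mul_ofReal, mul_one]

theorem integrable_mul_exp_neg {G : ℝ × ℝ → ℂ} (hG : Integrable G) (ξ : ℝ × ℝ) :
    Integrable fun x : ℝ × ℝ =>
      G x * Complex.exp (-Complex.I * ((x.1 * ξ.1 + x.2 * ξ.2 : ℝ) : ℂ)) := by
  refine hG.mul_bdd (c := 1) ?_ ?_
  · exact (by fun_prop : Continuous fun x : ℝ × ℝ =>
      Complex.exp (-Complex.I * ((x.1 * ξ.1 + x.2 * ξ.2 : ℝ) : ℂ))).aestronglyMeasurable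
  · exact Eventually.of_forall fun x => (norm_exp_neg_I_mul_ofReal _).le

theorem continuous_planeFourier {G : ℝ × ℝ → ℂ} (hG : Integrable G) :
    Continuous (planeFourier G) := by
  refine continuous_of_dominated (bound := fun x => ‖G x‖) ?_ ?_ hG.norm ?_
  · exact fun ξ => (integrable_mul_exp_neg hG ξ).aestronglyMeasurable
  · intro ξ
    refine Eventually.of_forall fun x => ?_
    rw [norm_mul, norm_exp_neg_I_mul_ofReal, mul_one]
  · exact Eventually.of_forall fun x => by fun_prop

/-- The standard inversion theorem uses the kernel e^{-2πi⟨v,w⟩} on an inner product space. `WithLp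
2` supplies the inner product, and the substitution ξ = 2πw in two dimensions produces the factor
1/(4π²). -/
theorem planeFourier_inversion {G : ℝ × ℝ → ℂ} (hc : Continuous G) (hG : Integrable G)
    (hF : Integrable (planeFourier G)) (x : ℝ × ℝ) :
    (1 / (4 * (Real.pi : ℂ) ^ 2)) * ∫ ξ : ℝ × ℝ, planeFourier G ξ *
      Complex.exp (Complex.I * ((x.1 * ξ.1 + x.2 * ξ.2 : ℝ) : ℂ)) = G x := by
  have hmp := WithLp.volume_preserving_ofLp ℝ ℝ
  have hemb : MeasurableEmbedding (WithLp.ofLp : WithLp 2 (ℝ × ℝ) → ℝ × ℝ) :=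
    (MeasurableEquiv.toLp 2 (ℝ × ℝ)).symm.measurableEmbedding
  set g : WithLp 2 (ℝ × ℝ) → ℂ := fun v => G v.ofLp with hg
  have hgi : Integrable g := (hmp.integrable_comp_emb hemb).2 hG
  have hgc : Continuous g := hc.comp (WithLp.prod_continuous_ofLp 2 ℝ ℝ)
  have hfg : ∀ w, FourierTransform.fourier g w = planeFourier G ((2 * Real.pi) • w.ofLp) := by
    intro w
    rw [Real.fourier_eq', planeFourier, ← hmp.integral_comp hemb]
    refine integral_congr_ae (Eventually.of_forall fun v => ?_)
    simp only [hg, smul_eq_mul, WithLp.prod_inner_apply, Prod.smul_fst, Prod.smul_snd]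
    rw [mul_comm]
    congr 2
    simp
    ring
  have hfi : Integrable (FourierTransform.fourier g) := by
    have : FourierTransform.fourier g =
        (fun y : ℝ × ℝ => planeFourier G ((2 * Real.pi) • y)) ∘ WithLp.ofLp := funext hfg
    rw [this, hmp.integrable_comp_emb hemb]
    exact hF.comp_smul (by positivity)
  have hinv := congrFun (hgc.fourierInv_fourier_eq hgi hfi) (WithLp.toLp 2 x)
  rw [Real.fourierInv_eq'] at hinv
  rw [show G x = g (WithLp.toLp 2 x) from rfl, ← hinv]
  have h2 : ∫ v : WithLp 2 (ℝ × ℝ),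
      Complex.exp (↑(2 * Real.pi * inner ℝ v (WithLp.toLp 2 x)) * Complex.I) •
        FourierTransform.fourier g v =
      ∫ y : ℝ × ℝ, (fun ξ : ℝ × ℝ => planeFourier G ξ *
        Complex.exp (Complex.I * ((x.1 * ξ.1 + x.2 * ξ.2 : ℝ) : ℂ))) ((2 * Real.pi) • y) := by
    rw [← hmp.integral_comp hemb]
    refine integral_congr_ae (Eventually.of_forall fun v => ?_)
    simp only [hfg, smul_eq_mul, WithLp.prod_inner_apply, Prod.smul_fst, Prod.smul_snd]
    rw [mul_comm]
    congr 2
    simp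
    ring
  rw [h2, Measure.integral_comp_smul volume (fun ξ : ℝ × ℝ => planeFourier G ξ *
        Complex.exp (Complex.I * ((x.1 * ξ.1 + x.2 * ξ.2 : ℝ) : ℂ)))]
  simp only [Module.finrank_prod, Module.finrank_self, Complex.real_smul]
  congr 1
  rw [abs_of_pos (by positivity)]
  push_cast
  field_simp
  norm_num

theorem planeFourier_fderiv {G : ℝ × ℝ → ℂ} (hG : ContDiff ℝ 1 G) (hc : HasCompactSupport G)
    (v ξ : ℝ × ℝ) :
    planeFourier (fun x => fderiv ℝ G x v) ξ =
      Complex.I * ((v.1 * ξ.1 + v.2 * ξ.2 : ℝ) : ℂ) * planeFourier G ξ := by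
  set e : ℝ × ℝ → ℂ := fun x => Complex.exp (-Complex.I * ((x.1 * ξ.1 + x.2 * ξ.2 : ℝ) : ℂ))
    with he
  set L : ℝ × ℝ →L[ℝ] ℝ := ξ.1 • ContinuousLinearMap.fst ℝ ℝ ℝ + ξ.2 • ContinuousLinearMap.snd ℝ ℝ ℝ
  have hL : ∀ x, HasFDerivAt e (e x • (-Complex.I • (Complex.ofRealCLM.comp L))) x := by
    intro x
    have h1 : HasFDerivAt (fun x : ℝ × ℝ => ((x.1 * ξ.1 + x.2 * ξ.2 : ℝ) : ℂ))
        (Complex.ofRealCLM.comp L) x := by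
      have h0 := (Complex.ofRealCLM.comp L).hasFDerivAt (x := x)
      convert h0 using 2 with y
      simp [L, mul_comm]
    exact (h1.const_mul (-Complex.I)).cexp
  have hev : ∀ x, fderiv ℝ e x v = e x * (-Complex.I * ((v.1 * ξ.1 + v.2 * ξ.2 : ℝ) : ℂ)) := by
    intro x
    rw [(hL x).fderiv]
    simp [L, mul_comm]
    ring
  have hec : Continuous e := by fun_prop
  have hG' : Continuous fun x => fderiv ℝ G x v :=
    (hG.continuous_fderiv (by simp)).clm_apply continuous_const
  have hG's : HasCompactSupport fun x => fderiv ℝ G x v := hc.fderiv_apply ℝ v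
  have hparts := integral_mul_fderiv_eq_neg_fderiv_mul_of_integrable (μ := (volume : Measure (ℝ × ℝ)))
    (f := G) (g := e) (v := v)
    ((hG'.mul hec).integrable_of_hasCompactSupport hG's.mul_right)
    ((hG.continuous.mul (by simp only [hev]; fun_prop)).integrable_of_hasCompactSupport
      hc.mul_right)
    ((hG.continuous.mul hec).integrable_of_hasCompactSupport hc.mul_right)
    (fun x _ => (hG.differentiable (by simp)) x) (fun x _ => (hL x).differentiableAt)
  have h3 : planeFourier (fun x => fderiv ℝ G x v) ξ = - ∫ x, G x * fderiv ℝ e x v := by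
    rw [hparts, neg_neg]; rfl
  rw [h3, planeFourier, ← integral_const_mul, ← integral_neg]
  refine integral_congr_ae (Eventually.of_forall fun x => ?_)
  change -(G x * fderiv ℝ e x v) = _ * (G x * e x)
  rw [hev]
  ring

/-- The witness is (1 - Δ)G: each derivative contributes a factor i times the frequency. -/
theorem exists_planeFourier_eq_bracket_mul {G : ℝ × ℝ → ℂ} (hG : ContDiff ℝ ∞ G)
    (hc : HasCompactSupport G) :
    ∃ G' : ℝ × ℝ → ℂ, ContDiff ℝ ∞ G' ∧ HasCompactSupport G' ∧
      ∀ ξ, planeFourier G' ξ = ((1 + ξ.1 ^ 2 + ξ.2 ^ 2 : ℝ) : ℂ) * planeFourier G ξ := by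
  have hd : ∀ (v : ℝ × ℝ) {K : ℝ × ℝ → ℂ}, ContDiff ℝ ∞ K → ContDiff ℝ ∞ fun x => fderiv ℝ K x v :=
    fun v K hK => (hK.fderiv_right (m := ∞) (by simp)).clm_apply contDiff_const
  set D : ℝ × ℝ → (ℝ × ℝ → ℂ) → (ℝ × ℝ → ℂ) := fun v K x => fderiv ℝ K x v with hD
  have hDs : ∀ v K, ContDiff ℝ ∞ K → ContDiff ℝ ∞ (D v K) := fun v K hK => hd v hK
  have hDc : ∀ v K, HasCompactSupport K → HasCompactSupport (D v K) :=
    fun v K hK => hK.fderiv_apply ℝ v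
  have hDF : ∀ v ξ, planeFourier (D v (D v G)) ξ =
      -((v.1 * ξ.1 + v.2 * ξ.2 : ℝ) : ℂ) ^ 2 * planeFourier G ξ := by
    intro v ξ
    simp only [hD]
    rw [planeFourier_fderiv ((hd v hG).of_le (by simp)) (hc.fderiv_apply ℝ v),
      planeFourier_fderiv (hG.of_le (by simp)) hc]
    linear_combination ((v.1 * ξ.1 + v.2 * ξ.2 : ℝ) : ℂ) ^ 2 * planeFourier G ξ * Complex.I_sq
  set A := D (1, 0) (D (1, 0) G)
  set B := D (0, 1) (D (0, 1) G)
  have hA : ContDiff ℝ ∞ A := hDs _ _ (hDs _ _ hG)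
  have hB : ContDiff ℝ ∞ B := hDs _ _ (hDs _ _ hG)
  have hAc : HasCompactSupport A := hDc _ _ (hDc _ _ hc)
  have hBc : HasCompactSupport B := hDc _ _ (hDc _ _ hc)
  refine ⟨G + (-A) + (-B), (hG.add hA.neg).add hB.neg, (hc.add hAc.neg).add hBc.neg, fun ξ => ?_⟩
  have hi : ∀ {K : ℝ × ℝ → ℂ}, ContDiff ℝ ∞ K → HasCompactSupport K → Integrable fun x : ℝ × ℝ =>
      K x * Complex.exp (-Complex.I * ((x.1 * ξ.1 + x.2 * ξ.2 : ℝ) : ℂ)) := fun hK hKc =>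
    integrable_mul_exp_neg (hK.continuous.integrable_of_hasCompactSupport hKc) ξ
  have hsum : planeFourier (G + (-A) + (-B)) ξ =
      planeFourier G ξ - planeFourier A ξ - planeFourier B ξ := by
    have h1 := integral_sub (hi hG hc) (hi hA hAc)
    have h2 := integral_sub ((hi hG hc).sub (hi hA hAc)) (hi hB hBc)
    simp only [planeFourier]
    rw [← h1]
    refine Eq.trans (integral_congr_ae (Eventually.of_forall fun x => ?_)) h2
    simp only [Pi.add_apply, Pi.neg_apply, Pi.sub_apply]
    ring
  rw [hsum, hDF, hDF]
  push_cast
  ring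

theorem exists_planeFourier_eq_bracket_pow_mul {G : ℝ × ℝ → ℂ} (hG : ContDiff ℝ ∞ G)
    (hc : HasCompactSupport G) (n : ℕ) :
    ∃ G' : ℝ × ℝ → ℂ, ContDiff ℝ ∞ G' ∧ HasCompactSupport G' ∧
      ∀ ξ, planeFourier G' ξ = ((1 + ξ.1 ^ 2 + ξ.2 ^ 2 : ℝ) : ℂ) ^ n * planeFourier G ξ := by
  induction n with
  | zero => exact ⟨G, hG, hc, fun ξ => by simp⟩
  | succ n ih =>
    obtain ⟨K, hK, hKc, hKF⟩ := ih
    obtain ⟨K', hK', hKc', hKF'⟩ := exists_planeFourier_eq_bracket_mul hK hKc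
    exact ⟨K', hK', hKc', fun ξ => by rw [hKF', hKF]; ring⟩

theorem exists_planeFourier_lipschitz {G : ℝ × ℝ → ℂ} (hG : Continuous G)
    (hc : HasCompactSupport G) :
    ∃ C, ∀ ξ η : ℝ × ℝ, ‖planeFourier G ξ - planeFourier G η‖ ≤
      C * (|ξ.1 - η.1| + |ξ.2 - η.2|) := by
  have hi := hG.integrable_of_hasCompactSupport (μ := volume) hc
  have hi2 : Integrable fun x : ℝ × ℝ => ‖G x‖ * (|x.1| + |x.2|) :=
    (by fun_prop : Continuous fun x : ℝ × ℝ => ‖G x‖ * (|x.1| + |x.2|)).integrable_of_hasCompactSupport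
      hc.norm.mul_right
  refine ⟨∫ x, ‖G x‖ * (|x.1| + |x.2|), fun ξ η => ?_⟩
  rw [planeFourier, planeFourier, ← integral_sub (integrable_mul_exp_neg hi ξ)
    (integrable_mul_exp_neg hi η), ← integral_mul_const]
  refine norm_integral_le_of_norm_le (hi2.mul_const _) (Eventually.of_forall fun x => ?_)
  rw [← mul_sub, norm_mul, mul_assoc]
  refine mul_le_mul_of_nonneg_left ?_ (norm_nonneg _)
  set a : ℝ := x.1 * ξ.1 + x.2 * ξ.2
  set b : ℝ := x.1 * η.1 + x.2 * η.2
  have h1 : Complex.exp (-Complex.I * (a : ℂ)) - Complex.exp (-Complex.I * (b : ℂ)) =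
      Complex.exp (-Complex.I * (b : ℂ)) * (Complex.exp (Complex.I * ((b - a : ℝ) : ℂ)) - 1) := by
    rw [mul_sub, ← Complex.exp_add, mul_one]
    congr 2
    push_cast
    ring
  rw [h1, norm_mul, norm_exp_neg_I_mul_ofReal, one_mul]
  refine (Real.norm_exp_I_mul_ofReal_sub_one_le).trans ?_
  rw [Real.norm_eq_abs]
  have h2 : b - a = -(x.1 * (ξ.1 - η.1) + x.2 * (ξ.2 - η.2)) := by simp only [a, b]; ring
  rw [h2, abs_neg]
  refine (abs_add_le _ _).trans ?_
  rw [abs_mul, abs_mul]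
  nlinarith [abs_nonneg x.1, abs_nonneg x.2, abs_nonneg (ξ.1 - η.1), abs_nonneg (ξ.2 - η.2)]

/-- The Fourier transform of a test function decays rapidly; on circles centred at the origin,
so do its difference quotients. -/
theorem exists_planeFourier_decay {G : ℝ × ℝ → ℂ} (hG : ContDiff ℝ ∞ G)
    (hc : HasCompactSupport G) (n : ℕ) :
    ∃ C, 0 ≤ C ∧ (∀ ξ : ℝ × ℝ, ‖planeFourier G ξ‖ ≤ C / (1 + ξ.1 ^ 2 + ξ.2 ^ 2) ^ n) ∧
      ∀ ξ η : ℝ × ℝ, ξ.1 ^ 2 + ξ.2 ^ 2 = η.1 ^ 2 + η.2 ^ 2 →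
        ‖planeFourier G ξ - planeFourier G η‖ ≤
          C / (1 + ξ.1 ^ 2 + ξ.2 ^ 2) ^ n * (|ξ.1 - η.1| + |ξ.2 - η.2|) := by
  obtain ⟨K, hK, hKc, hKF⟩ := exists_planeFourier_eq_bracket_pow_mul hG hc n
  obtain ⟨C, hC⟩ := exists_planeFourier_lipschitz hK.continuous hKc
  have hpos : ∀ ξ : ℝ × ℝ, 0 < (1 + ξ.1 ^ 2 + ξ.2 ^ 2) ^ n := fun ξ => by positivity
  have hnorm : ∀ ξ : ℝ × ℝ, ‖(((1 + ξ.1 ^ 2 + ξ.2 ^ 2 : ℝ) : ℂ)) ^ n‖ =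
      (1 + ξ.1 ^ 2 + ξ.2 ^ 2) ^ n := fun ξ => by
    rw [norm_pow, Complex.norm_real, Real.norm_of_nonneg (by positivity)]
  refine ⟨max (∫ x, ‖K x‖) C, le_max_of_le_left (by positivity), fun ξ => ?_, fun ξ η h => ?_⟩
  · rw [le_div_iff₀ (hpos ξ), mul_comm, ← hnorm, ← norm_mul, ← hKF]
    exact (norm_planeFourier_le K ξ).trans (le_max_left _ _)
  -- The factor (1+|ξ|²)^n is the same at ξ and η, so it moves inside the difference, where the
  -- Lipschitz bound for (1-Δ)^n G applies.
  · rw [div_mul_eq_mul_div, le_div_iff₀ (hpos ξ), mul_comm, ← hnorm, ← norm_mul, mul_sub, ← hKF,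
      show 1 + ξ.1 ^ 2 + ξ.2 ^ 2 = 1 + η.1 ^ 2 + η.2 ^ 2 by linarith, ← hKF]
    exact (hC ξ η).trans (mul_le_mul_of_nonneg_right (le_max_right _ _) (by positivity))

/-! ### Dini's test with a Gaussian comparison function -/

theorem integral_exp_I_mul_gaussian (p x₀ : ℝ) :
    ∫ s : ℝ, Complex.exp (Complex.I * ((p * (s - x₀) : ℝ) : ℂ)) *
      ((Real.exp (-(1 / 2) * (s - x₀) ^ 2) : ℝ) : ℂ) =
      ((√(2 * Real.pi) * Real.exp (-(1 / 2) * p ^ 2) : ℝ) : ℂ) := by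
  rw [integral_sub_right_eq_self (fun s : ℝ => Complex.exp (Complex.I * ((p * s : ℝ) : ℂ)) *
      ((Real.exp (-(1 / 2) * s ^ 2) : ℝ) : ℂ)) x₀]
  have h := fourierIntegral_gaussian (b := ((1 / 2 : ℝ) : ℂ)) (by norm_num) (p : ℂ)
  have h2 : ((Real.pi : ℂ) / ((1 / 2 : ℝ) : ℂ)) ^ (1 / 2 : ℂ) = ((√(2 * Real.pi) : ℝ) : ℂ) := by
    rw [Real.sqrt_eq_rpow, Complex.ofReal_cpow (by positivity)]
    congr 1 <;> push_cast <;> ring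
  rw [h2] at h
  refine Eq.trans (integral_congr_ae (Eventually.of_forall fun s => ?_)) (h.trans ?_)
  · simp only [Complex.ofReal_exp]
    congr 2 <;> push_cast <;> ring
  · push_cast
    congr 2
    ring

theorem integral_exp_neg_half_sq : ∫ p : ℝ, Real.exp (-(1 / 2) * p ^ 2) = √(2 * Real.pi) := by
  rw [integral_gaussian]
  congr 1
  ring

theorem integrable_exp_neg_half_sq : Integrable fun p : ℝ => Real.exp (-(1 / 2) * p ^ 2) :=
  integrable_exp_neg_mul_sq (by norm_num)

/-- Kept in product form so that it also holds at x = 0. The factor x is later supplied by the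
remainder, which is (s - x₀) times the Dini quotient. -/
theorem mul_setIntegral_exp_I {a b x : ℝ} (hab : -a ≤ b) :
    (x : ℂ) * ∫ p in Set.Icc (-a) b, Complex.exp (Complex.I * ((p * x : ℝ) : ℂ)) =
      -Complex.I * (Complex.exp (Complex.I * ((b * x : ℝ) : ℂ)) -
        Complex.exp (Complex.I * ((-a * x : ℝ) : ℂ))) := by
  rcases eq_or_ne x 0 with rfl | hx
  · simp
  rw [integral_Icc_eq_integral_Ioc, ← intervalIntegral.integral_of_le hab]
  have h : ∀ p : ℝ, Complex.exp (Complex.I * ((p * x : ℝ) : ℂ)) =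
      Complex.exp ((Complex.I * x) * p) := fun p => by congr 1; push_cast; ring
  have hx' : (x : ℂ) ≠ 0 := by exact_mod_cast hx
  simp only [h]
  rw [integral_exp_mul_complex (mul_ne_zero Complex.I_ne_zero hx')]
  field_simp
  rw [Complex.I_sq]
  push_cast
  ring

/-- The remainder in Dini's test, with a Gaussian as comparison function. -/
noncomputable def diniQuotient (d : ℝ → ℂ) (c : ℂ) (x₀ s : ℝ) : ℂ :=
  (d s - c * ((Real.exp (-(1 / 2) * (s - x₀) ^ 2) : ℝ) : ℂ)) / ((s - x₀ : ℝ) : ℂ)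

/-- The truncated Fourier integral of `d̂` at `x₀`. -/
noncomputable def truncatedFourierIntegral (a b : ℝ) (d : ℝ → ℂ) (x₀ : ℝ) : ℂ :=
  ∫ p in Set.Icc (-a) b, ∫ s : ℝ, Complex.exp (Complex.I * ((p * (s - x₀) : ℝ) : ℂ)) * d s

theorem integrable_exp_mul {d : ℝ → ℂ} (hd : Integrable d) (p x₀ : ℝ) :
    Integrable fun s : ℝ => Complex.exp (Complex.I * ((p * (s - x₀) : ℝ) : ℂ)) * d s := by
  refine hd.bdd_mul (c := 1) (by fun_prop) ?_
  exact Eventually.of_forall fun s => (norm_exp_I_mul_ofReal _).le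

/-- Subtract c times a Gaussian centred at x₀, whose Fourier integral is explicit. In the rest,
Fubini allows the p-integral to be done first; the factor s - x₀ cancels its denominator and only
the boundary frequencies b and -a remain. -/
theorem truncatedFourierIntegral_eq {d : ℝ → ℂ} (hd : Integrable d) {c : ℂ} {x₀ : ℝ}
    (hq : Integrable (diniQuotient d c x₀)) {a b : ℝ} (hab : -a ≤ b) :
    truncatedFourierIntegral a b d x₀ =
      c * ((√(2 * Real.pi) : ℝ) : ℂ) *
          ((∫ p in Set.Icc (-a) b, Real.exp (-(1 / 2) * p ^ 2) : ℝ) : ℂ) +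
        -Complex.I * ((∫ s, Complex.exp (Complex.I * ((b * (s - x₀) : ℝ) : ℂ)) *
            diniQuotient d c x₀ s) -
          ∫ s, Complex.exp (Complex.I * ((-a * (s - x₀) : ℝ) : ℂ)) * diniQuotient d c x₀ s) := by
  set k : ℝ → ℂ := fun s => ((Real.exp (-(1 / 2) * (s - x₀) ^ 2) : ℝ) : ℂ) with hk
  set r : ℝ → ℂ := fun s => d s - c * k s with hr
  have hki : Integrable k := (integrable_exp_neg_half_sq.comp_sub_right x₀).ofReal
  have hri : Integrable r := hd.sub (hki.const_mul c)
  have hrq : ∀ᵐ s : ℝ, r s = ((s - x₀ : ℝ) : ℂ) * diniQuotient d c x₀ s := by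
    filter_upwards [(measure_singleton x₀ : volume {x₀} = 0) |> compl_mem_ae_iff.2] with s hs
    have h1 : s - x₀ ≠ 0 := sub_ne_zero.2 hs
    have h2 : ((s - x₀ : ℝ) : ℂ) ≠ 0 := by exact_mod_cast h1
    rw [diniQuotient, mul_div_cancel₀ _ h2]
  have hinner : ∀ p : ℝ, ∫ s : ℝ, Complex.exp (Complex.I * ((p * (s - x₀) : ℝ) : ℂ)) * d s =
      c * (((√(2 * Real.pi) : ℝ) : ℂ) * ((Real.exp (-(1 / 2) * p ^ 2) : ℝ) : ℂ)) +
        ∫ s : ℝ, Complex.exp (Complex.I * ((p * (s - x₀) : ℝ) : ℂ)) * r s := by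
    intro p
    rw [← Complex.ofReal_mul, ← integral_exp_I_mul_gaussian p x₀, ← integral_const_mul,
      ← integral_add ((integrable_exp_mul hki p x₀).const_mul c) (integrable_exp_mul hri p x₀)]
    refine integral_congr_ae (Eventually.of_forall fun s => ?_)
    simp only [hr, hk]
    ring
  have hprod : Integrable (Function.uncurry fun (p s : ℝ) =>
      Complex.exp (Complex.I * ((p * (s - x₀) : ℝ) : ℂ)) * r s)
      ((volume.restrict (Set.Icc (-a) b)).prod volume) := by
    have h1 : Integrable (fun z : ℝ × ℝ => r z.2)
        ((volume.restrict (Set.Icc (-a) b)).prod volume) := hri.comp_snd _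
    refine h1.bdd_mul (c := 1) (by fun_prop) ?_
    exact Eventually.of_forall fun s => (norm_exp_I_mul_ofReal _).le
  rw [truncatedFourierIntegral]
  simp only [hinner]
  rw [integral_add]
  rotate_left
  · exact ((integrable_exp_neg_half_sq.ofReal.const_mul _).const_mul _).integrableOn
  · exact hprod.integral_prod_left
  congr 1
  · rw [integral_const_mul, integral_const_mul, mul_assoc, integral_complex_ofReal]
  · rw [integral_integral_swap hprod, ← integral_sub (integrable_exp_mul hq b x₀)
      (integrable_exp_mul hq (-a) x₀), ← integral_const_mul]
    refine integral_congr_ae ?_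
    filter_upwards [hrq] with s hs
    rw [integral_mul_const, hs, ← mul_assoc, mul_comm (∫ p in _, _), mul_setIntegral_exp_I hab]
    ring

/-- The point is independence of a and b: the Gaussian integral is at most √(2π), and each of the
two boundary terms is at most the L¹ norm of the quotient. -/
theorem norm_truncatedFourierIntegral_le {d : ℝ → ℂ} (hd : Integrable d) {c : ℂ} {x₀ : ℝ}
    (hq : Integrable (diniQuotient d c x₀)) (a b : ℝ) :
    ‖truncatedFourierIntegral a b d x₀‖ ≤
      2 * Real.pi * ‖c‖ + 2 * ∫ s, ‖diniQuotient d c x₀ s‖ := by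
  have hq0 : 0 ≤ ∫ s, ‖diniQuotient d c x₀ s‖ := integral_nonneg fun s => norm_nonneg _
  rcases lt_or_ge b (-a) with h | hab
  · rw [truncatedFourierIntegral, Set.Icc_eq_empty (not_le.2 h)]
    simp only [Measure.restrict_empty, integral_zero_measure, norm_zero]
    positivity
  rw [truncatedFourierIntegral_eq hd hq hab]
  have hQ : ∀ w : ℝ, ‖∫ s, Complex.exp (Complex.I * ((w * (s - x₀) : ℝ) : ℂ)) *
      diniQuotient d c x₀ s‖ ≤ ∫ s, ‖diniQuotient d c x₀ s‖ := by
    intro w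
    refine (norm_integral_le_integral_norm _).trans_eq ?_
    simp only [norm_mul, norm_exp_I_mul_ofReal, one_mul]
  have hg0 : 0 ≤ ∫ p in Set.Icc (-a) b, Real.exp (-(1 / 2) * p ^ 2) :=
    integral_nonneg fun _ => (Real.exp_pos _).le
  have hg : ∫ p in Set.Icc (-a) b, Real.exp (-(1 / 2) * p ^ 2) ≤ √(2 * Real.pi) := by
    rw [← integral_exp_neg_half_sq]
    exact setIntegral_le_integral integrable_exp_neg_half_sq
      (Eventually.of_forall fun _ => (Real.exp_pos _).le)
  refine (norm_add_le _ _).trans (add_le_add ?_ ?_)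
  · rw [norm_mul, norm_mul, Complex.norm_real, Complex.norm_real, Real.norm_of_nonneg hg0,
      Real.norm_of_nonneg (Real.sqrt_nonneg _)]
    have h2 : √(2 * Real.pi) * √(2 * Real.pi) = 2 * Real.pi := Real.mul_self_sqrt (by positivity)
    calc ‖c‖ * √(2 * Real.pi) * ∫ p in Set.Icc (-a) b, Real.exp (-(1 / 2) * p ^ 2)
        ≤ ‖c‖ * √(2 * Real.pi) * √(2 * Real.pi) := by gcongr
      _ = 2 * Real.pi * ‖c‖ := by rw [mul_assoc, h2, mul_comm]
  · rw [norm_mul, norm_neg, Complex.norm_I, one_mul, two_mul]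
    exact (norm_sub_le _ _).trans (add_le_add (hQ b) (hQ (-a)))

/-- The Riemann–Lebesgue lemma, with frequency rescaled by -1/(2π). Passing to norms discards the
unimodular factor due to the shift by x₀. -/
theorem tendsto_integral_exp_mul_cocompact (q : ℝ → ℂ) (x₀ : ℝ) :
    Tendsto (fun w : ℝ => ∫ s, Complex.exp (Complex.I * ((w * (s - x₀) : ℝ) : ℂ)) * q s)
      (cocompact ℝ) (𝓝 0) := by
  have h := (Real.tendsto_integral_exp_smul_cocompact q).comp
    (Homeomorph.mulRight₀ (-(1 / (2 * Real.pi))) (by simp [Real.pi_ne_zero])).toCocompactMap.cocompact_tendsto'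
  rw [tendsto_zero_iff_norm_tendsto_zero] at h ⊢
  refine h.congr fun w => ?_
  simp only [Function.comp]
  have : ∀ s : ℝ, Complex.exp (Complex.I * ((w * (s - x₀) : ℝ) : ℂ)) * q s =
      Complex.exp (Complex.I * ((-(w * x₀) : ℝ) : ℂ)) *
        (Complex.exp (Complex.I * ((w * s : ℝ) : ℂ)) * q s) := by
    intro s
    rw [← mul_assoc, ← Complex.exp_add]
    congr 2
    push_cast
    ring
  simp only [this]
  rw [integral_const_mul, norm_mul, norm_exp_I_mul_ofReal, one_mul]
  congr 1
  refine integral_congr_ae (Eventually.of_forall fun s => ?_)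
  simp only [Circle.smul_def, Real.fourierChar_apply, smul_eq_mul]
  congr 2
  have : (Real.pi : ℂ) ≠ 0 := by exact_mod_cast Real.pi_ne_zero
  simp
  field_simp

/-- **Dini's test**: the Fourier integral converges when its two limits of integration tend to
infinity independently. -/
theorem tendsto_truncatedFourierIntegral {d : ℝ → ℂ} (hd : Integrable d) {c : ℂ} {x₀ : ℝ}
    (hq : Integrable (diniQuotient d c x₀)) :
    Tendsto (fun ab : ℝ × ℝ => truncatedFourierIntegral ab.1 ab.2 d x₀) (atTop ×ˢ atTop)
      (𝓝 (2 * Real.pi * c)) := by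
  have h1 : Tendsto (fun ab : ℝ × ℝ => ∫ p in Set.Icc (-ab.1) ab.2, Real.exp (-(1 / 2) * p ^ 2))
      (atTop ×ˢ atTop) (𝓝 (√(2 * Real.pi))) := by
    rw [← integral_exp_neg_half_sq]
    exact (aecover_Icc (tendsto_neg_atTop_atBot.comp tendsto_fst)
      tendsto_snd).integral_tendsto_of_countably_generated integrable_exp_neg_half_sq
  have hQ := tendsto_integral_exp_mul_cocompact (diniQuotient d c x₀) x₀
  have h2 := hQ.comp ((tendsto_snd (f := (atTop : Filter ℝ))
    (g := (atTop : Filter ℝ))).mono_right atTop_le_cocompact)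
  have h3 := hQ.comp ((tendsto_neg_atTop_atBot.comp
    (tendsto_fst (f := (atTop : Filter ℝ)) (g := (atTop : Filter ℝ)))).mono_right
      atBot_le_cocompact)
  have hlim := (h1.ofReal.const_mul (c * ((√(2 * Real.pi) : ℝ) : ℂ))).add
    ((h2.sub h3).const_mul (-Complex.I))
  have hval : c * ((√(2 * Real.pi) : ℝ) : ℂ) * ((√(2 * Real.pi) : ℝ) : ℂ) + -Complex.I * (0 - 0) =
      2 * Real.pi * c := by
    rw [mul_assoc, ← Complex.ofReal_mul, Real.mul_self_sqrt (by positivity)]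
    push_cast
    ring
  rw [hval] at hlim
  refine hlim.congr' ?_
  filter_upwards [(eventually_ge_atTop (0 : ℝ)).prod_mk (eventually_ge_atTop (0 : ℝ))] with ab h
  exact (truncatedFourierIntegral_eq hd hq (by linarith [h.1, h.2])).symm

/-! ### Integrable weights with singularities of order 3/4 -/

theorem integrable_comp_abs_of_integrableOn_Ioi {φ : ℝ → ℝ} (h : IntegrableOn φ (Set.Ioi 0)) :
    Integrable fun x : ℝ => φ |x| := by
  have hg : Integrable ((Set.Ioi (0 : ℝ)).indicator φ) := (integrable_indicator_iff measurableSet_Ioi).2 h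
  refine (hg.add hg.comp_neg).congr ?_
  filter_upwards [(measure_singleton (0 : ℝ) : volume {(0 : ℝ)} = 0) |> compl_mem_ae_iff.2] with x hx
  rcases lt_or_gt_of_ne (show x ≠ 0 from hx) with h0 | h0
  · simp [h0, h0.le, abs_of_neg]
  · simp [h0, h0.le, abs_of_pos]

/-- The weight `(1 - s²)^{-3/4}` on `(-1, 1)`. -/
noncomputable def unitArcWeight (s : ℝ) : ℝ :=
  (Set.Ioo (-1 : ℝ) 1).indicator (fun s => 1 / (√(1 - s ^ 2) * √√(1 - s ^ 2))) s

/-- The weight `(R² - s²)^{-3/4}` on `(-R, R)`. -/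
noncomputable def arcWeight (R s : ℝ) : ℝ :=
  (Set.Ioo (-R) R).indicator (fun s => 1 / (√(R ^ 2 - s ^ 2) * √√(R ^ 2 - s ^ 2))) s

theorem unitArcWeight_nonneg (s : ℝ) : 0 ≤ unitArcWeight s :=
  Set.indicator_nonneg (fun _ _ => by positivity) s

theorem arcWeight_nonneg (R s : ℝ) : 0 ≤ arcWeight R s :=
  Set.indicator_nonneg (fun _ _ => by positivity) s

/-- On (-1,1) one has 1 - s² ≥ 1 - |s|, so (1 - |s|)^{-3/4} is an integrable majorant. -/
theorem integrable_unitArcWeight : Integrable unitArcWeight := by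
  have h1 : IntegrableOn (fun x : ℝ => (1 - x) ^ (-(3 / 4) : ℝ)) (Set.Ioo 0 1) := by
    have h := (intervalIntegral.intervalIntegrable_rpow' (a := 0) (b := 1) (r := -(3 / 4))
      (by norm_num)).comp_sub_left 1
    simp only [sub_zero, sub_self] at h
    exact (intervalIntegrable_iff_integrableOn_Ioo_of_le zero_le_one).1 h.symm
  have h2 : IntegrableOn ((Set.Ioo (0 : ℝ) 1).indicator fun x : ℝ => (1 - x) ^ (-(3 / 4) : ℝ))
      (Set.Ioi 0) := ((integrable_indicator_iff measurableSet_Ioo).2 h1).integrableOn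
  refine (integrable_comp_abs_of_integrableOn_Ioi h2).mono' ?_ ?_
  · exact (Measurable.indicator (by fun_prop) measurableSet_Ioo).aestronglyMeasurable
  filter_upwards [(measure_singleton (0 : ℝ) : volume {(0 : ℝ)} = 0) |> compl_mem_ae_iff.2] with s hs
  rw [Real.norm_of_nonneg (unitArcWeight_nonneg s), unitArcWeight]
  by_cases hmem : s ∈ Set.Ioo (-1 : ℝ) 1
  · have habs : |s| ∈ Set.Ioo (0 : ℝ) 1 := ⟨abs_pos.2 hs, abs_lt.2 hmem⟩
    rw [Set.indicator_of_mem hmem, Set.indicator_of_mem habs]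
    set m := 1 - |s| with hm
    have hm0 : 0 < m := by linarith [habs.2]
    have hle : m ≤ 1 - s ^ 2 := by
      rw [← sq_abs]
      nlinarith [habs.1, habs.2]
    have hpow : m ^ (-(3 / 4) : ℝ) = 1 / (√m * √√m) := by
      rw [Real.sqrt_eq_rpow, Real.sqrt_eq_rpow, ← Real.rpow_mul hm0.le, ← Real.rpow_add hm0,
        Real.rpow_neg hm0.le, one_div]
      norm_num
    rw [hpow]
    gcongr
  · rw [Set.indicator_of_notMem hmem]
    exact Set.indicator_nonneg (fun x hx => Real.rpow_nonneg (by linarith [hx.2]) _) _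

theorem arcWeight_eq {R : ℝ} (hR : 0 < R) (s : ℝ) :
    arcWeight R s = 1 / (R * √R) * unitArcWeight (R⁻¹ * s) := by
  by_cases hs : s ∈ Set.Ioo (-R) R
  · have hs' : R⁻¹ * s ∈ Set.Ioo (-1 : ℝ) 1 := by
      rw [inv_mul_eq_div, Set.mem_Ioo, lt_div_iff₀ hR, div_lt_iff₀ hR]
      exact ⟨by linarith [hs.1], by linarith [hs.2]⟩
    rw [arcWeight, unitArcWeight, Set.indicator_of_mem hs, Set.indicator_of_mem hs']
    have h1 : R ^ 2 - s ^ 2 = R ^ 2 * (1 - (R⁻¹ * s) ^ 2) := by field_simp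
    rw [h1, Real.sqrt_mul (by positivity), Real.sqrt_sq hR.le, Real.sqrt_mul hR.le]
    rw [one_div_mul_one_div]
    congr 1
    ring
  · have hs' : R⁻¹ * s ∉ Set.Ioo (-1 : ℝ) 1 := by
      rw [inv_mul_eq_div, Set.mem_Ioo, lt_div_iff₀ hR, div_lt_iff₀ hR]
      intro h
      exact hs ⟨by linarith [h.1], by linarith [h.2]⟩
    rw [arcWeight, unitArcWeight, Set.indicator_of_notMem hs, Set.indicator_of_notMem hs', mul_zero]

theorem integrable_arcWeight {R : ℝ} (hR : 0 < R) : Integrable (arcWeight R) := by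
  rw [show arcWeight R = fun s => 1 / (R * √R) * unitArcWeight (R⁻¹ * s) from
    funext (arcWeight_eq hR)]
  exact (integrable_unitArcWeight.comp_mul_left' (inv_ne_zero hR.ne')).const_mul _

theorem integral_arcWeight {R : ℝ} (hR : 0 < R) :
    ∫ s, arcWeight R s = (∫ s, unitArcWeight s) / √R := by
  simp only [arcWeight_eq hR]
  rw [integral_const_mul, Measure.integral_comp_mul_left, inv_inv, abs_of_pos hR, smul_eq_mul]
  have : 0 < √R := Real.sqrt_pos.2 hR
  field_simp

/-- The weight `|x|^{-3/4} e^{-x²/2}`. -/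
noncomputable def gaussianPoleWeight (x : ℝ) : ℝ :=
  Real.exp (-(1 / 2) * x ^ 2) * √√|x| / |x|

theorem gaussianPoleWeight_nonneg (x : ℝ) : 0 ≤ gaussianPoleWeight x := by
  unfold gaussianPoleWeight; positivity

theorem integrable_gaussianPoleWeight : Integrable gaussianPoleWeight := by
  have h1 := (integrable_rpow_mul_exp_neg_mul_sq (b := 1 / 2) (by norm_num) (s := -(3 / 4))
    (by norm_num)).integrableOn (s := Set.Ioi (0 : ℝ))
  have h2 : IntegrableOn (fun x : ℝ => Real.exp (-(1 / 2) * x ^ 2) * √√x / x) (Set.Ioi 0) := by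
    refine h1.congr_fun (fun x hx => ?_) measurableSet_Ioi
    have hx0 : (0 : ℝ) < x := hx
    have hpow : x ^ (-(3 / 4) : ℝ) = √√x / x := by
      rw [Real.sqrt_eq_rpow, Real.sqrt_eq_rpow, ← Real.rpow_mul hx0.le, eq_div_iff hx0.ne',
        ← Real.rpow_add_one hx0.ne']
      norm_num
    simp only [hpow]
    ring
  refine (integrable_comp_abs_of_integrableOn_Ioi h2).congr (Eventually.of_forall fun x => ?_)
  simp only [gaussianPoleWeight, sq_abs]

theorem one_sub_exp_neg_half_sq_le (x : ℝ) : 1 - Real.exp (-(1 / 2) * x ^ 2) ≤ |x| := by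
  have h1 := Real.add_one_le_exp (-(1 / 2) * x ^ 2)
  have h2 := Real.exp_pos (-(1 / 2) * x ^ 2)
  rcases le_total 1 |x| with h | h
  · linarith
  · nlinarith [sq_abs x, abs_nonneg x]

theorem exp_neg_half_sq_le_one (x : ℝ) : Real.exp (-(1 / 2) * x ^ 2) ≤ 1 :=
  Real.exp_le_one_iff.2 (by nlinarith [sq_nonneg x])

/-! ### Integrability of the Dini quotient on an arc -/

/-- A function on `(-R, R)`, extended by zero, whose difference quotient at `x₀` is controlled by
the weight `(R² - s²)^{-3/4}`. -/
structure ArcControlled (d : ℝ → ℂ) (c : ℂ) (R x₀ M : ℝ) : Prop where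
  measurable : Measurable d
  mem : x₀ ∈ Set.Ioo (-R) R
  nonneg : 0 ≤ M
  eq_zero : ∀ s, s ∉ Set.Ioo (-R) R → d s = 0
  bound : ∀ s ∈ Set.Ioo (-R) R, s ≠ x₀ → ‖d s - c‖ ≤ M * arcWeight R s * |s - x₀|

namespace ArcControlled

variable {d : ℝ → ℂ} {c : ℂ} {R x₀ M : ℝ}

theorem radius_pos (h : ArcControlled d c R x₀ M) : 0 < R := by
  linarith [h.mem.1, h.mem.2]

/-- Since √(R²-s²) ≤ R, the weight is at least R^{-3/2}; bounded terms can thus be absorbed into it.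
-/
theorem one_le_arcWeight {R s : ℝ} (hs : s ∈ Set.Ioo (-R) R) : 1 ≤ R * √R * arcWeight R s := by
  have hR : 0 < R := by linarith [hs.1, hs.2]
  rw [arcWeight, Set.indicator_of_mem hs]
  have h1 : 0 < R ^ 2 - s ^ 2 := by nlinarith [hs.1, hs.2]
  have h2 : √(R ^ 2 - s ^ 2) ≤ R := by
    rw [Real.sqrt_le_left hR.le]
    nlinarith [sq_nonneg s]
  rw [mul_one_div, le_div_iff₀ (by positivity), one_mul]
  gcongr

theorem integrable (h : ArcControlled d c R x₀ M) : Integrable d := by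
  have hR := h.radius_pos
  refine ((integrable_arcWeight hR).const_mul (‖c‖ * (R * √R) + M * (2 * R))).mono'
    h.measurable.aestronglyMeasurable ?_
  filter_upwards [(measure_singleton x₀ : volume {x₀} = 0) |> compl_mem_ae_iff.2] with s hs
  have hw := arcWeight_nonneg R s
  by_cases hmem : s ∈ Set.Ioo (-R) R
  · have h1 := h.bound s hmem hs
    have h2 : |s - x₀| ≤ 2 * R := by
      rw [abs_le]
      constructor <;> linarith [hmem.1, hmem.2, h.mem.1, h.mem.2]
    have h3 : ‖c‖ * 1 ≤ ‖c‖ * (R * √R * arcWeight R s) :=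
      mul_le_mul_of_nonneg_left (one_le_arcWeight hmem) (norm_nonneg c)
    have h4 : M * arcWeight R s * |s - x₀| ≤ M * arcWeight R s * (2 * R) :=
      mul_le_mul_of_nonneg_left h2 (mul_nonneg h.nonneg hw)
    have h5 : ‖d s‖ ≤ ‖d s - c‖ + ‖c‖ := by
      simpa using norm_add_le (d s - c) c
    nlinarith
  · rw [h.eq_zero s hmem, norm_zero]
    have := h.nonneg
    positivity

/-- The majorant of the remainder in Dini's test. -/
theorem norm_diniQuotient_le (h : ArcControlled d c R x₀ M) {s : ℝ} (hs : s ≠ x₀) :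
    ‖diniQuotient d c x₀ s‖ ≤ (M + ‖c‖ * (R * √R)) * arcWeight R s +
      ‖c‖ * (√√(2 * R) / √√(R ^ 2 - x₀ ^ 2)) * gaussianPoleWeight (s - x₀) := by
  have hR := h.radius_pos
  have hw := arcWeight_nonneg R s
  have hg := gaussianPoleWeight_nonneg (s - x₀)
  have hx : 0 < |s - x₀| := abs_pos.2 (sub_ne_zero.2 hs)
  have hM := h.nonneg
  have hk0 := Real.exp_pos (-(1 / 2) * (s - x₀) ^ 2)
  rw [diniQuotient, norm_div, Complex.norm_real, Real.norm_eq_abs]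
  by_cases hmem : s ∈ Set.Ioo (-R) R
  · refine le_add_of_le_of_nonneg ?_ (by positivity)
    rw [div_le_iff₀ hx]
    have h1 := h.bound s hmem hs
    have h2 : ‖c * ((1 - Real.exp (-(1 / 2) * (s - x₀) ^ 2) : ℝ) : ℂ)‖ ≤ ‖c‖ * |s - x₀| := by
      rw [norm_mul, Complex.norm_real, Real.norm_of_nonneg
        (sub_nonneg.2 (exp_neg_half_sq_le_one _))]
      exact mul_le_mul_of_nonneg_left (one_sub_exp_neg_half_sq_le _) (norm_nonneg c)
    have h3 : d s - c * ((Real.exp (-(1 / 2) * (s - x₀) ^ 2) : ℝ) : ℂ) =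
        (d s - c) + c * ((1 - Real.exp (-(1 / 2) * (s - x₀) ^ 2) : ℝ) : ℂ) := by
      push_cast
      ring
    rw [h3]
    have h4 : ‖c‖ * |s - x₀| * 1 ≤ ‖c‖ * |s - x₀| * (R * √R * arcWeight R s) :=
      mul_le_mul_of_nonneg_left (one_le_arcWeight hmem) (by positivity)
    refine (norm_add_le _ _).trans ((add_le_add h1 h2).trans ?_)
    nlinarith
  -- Off the interval only the Gaussian is left, divided by s - x₀, which may be small when x₀ is
  -- near an endpoint. There R² - x₀² ≤ 2R|s - x₀|, so a factor (2R|s - x₀|/(R² - x₀²))^{1/4} ≥ 1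
  -- may be inserted; it softens the pole to order 3/4.
  · refine le_add_of_nonneg_of_le (by positivity) ?_
    rw [h.eq_zero s hmem, zero_sub, norm_neg, norm_mul, Complex.norm_real,
      Real.norm_of_nonneg hk0.le, gaussianPoleWeight, mul_assoc, mul_div_assoc]
    refine mul_le_mul_of_nonneg_left ?_ (norm_nonneg c)
    have hpos : 0 < R ^ 2 - x₀ ^ 2 := by nlinarith [h.mem.1, h.mem.2]
    have h1 : R ^ 2 - x₀ ^ 2 ≤ 2 * R * |s - x₀| := by
      have hx1 := h.mem.1
      have hx2 := h.mem.2
      rw [Set.mem_Ioo, not_and_or, not_lt, not_lt] at hmem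
      rcases hmem with h6 | h6
      · have := neg_abs_le (s - x₀)
        nlinarith
      · have := le_abs_self (s - x₀)
        nlinarith
    have h2 : √√(R ^ 2 - x₀ ^ 2) ≤ √√(2 * R) * √√|s - x₀| := by
      rw [← Real.sqrt_mul (Real.sqrt_nonneg _), ← Real.sqrt_mul (by positivity)]
      exact Real.sqrt_le_sqrt (Real.sqrt_le_sqrt h1)
    have h3 : 0 < √√(R ^ 2 - x₀ ^ 2) := by positivity
    rw [div_mul_eq_mul_div, div_le_div_iff₀ hx h3]
    have h4 : √√(2 * R) * (Real.exp (-(1 / 2) * (s - x₀) ^ 2) * √√|s - x₀| / |s - x₀|) * |s - x₀| =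
        Real.exp (-(1 / 2) * (s - x₀) ^ 2) * (√√(2 * R) * √√|s - x₀|) := by
      field_simp
    rw [h4]
    exact mul_le_mul_of_nonneg_left h2 hk0.le

theorem measurable_diniQuotient (h : ArcControlled d c R x₀ M) :
    Measurable (diniQuotient d c x₀) := by
  have := h.measurable
  unfold diniQuotient
  fun_prop

theorem integrable_majorant (h : ArcControlled d c R x₀ M) :
    Integrable fun s => (M + ‖c‖ * (R * √R)) * arcWeight R s +
      ‖c‖ * (√√(2 * R) / √√(R ^ 2 - x₀ ^ 2)) * gaussianPoleWeight (s - x₀) :=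
  ((integrable_arcWeight h.radius_pos).const_mul _).add
    ((integrable_gaussianPoleWeight.comp_sub_right x₀).const_mul _)

theorem ae_norm_diniQuotient_le (h : ArcControlled d c R x₀ M) :
    ∀ᵐ s, ‖diniQuotient d c x₀ s‖ ≤ (M + ‖c‖ * (R * √R)) * arcWeight R s +
      ‖c‖ * (√√(2 * R) / √√(R ^ 2 - x₀ ^ 2)) * gaussianPoleWeight (s - x₀) := by
  filter_upwards [(measure_singleton x₀ : volume {x₀} = 0) |> compl_mem_ae_iff.2] with s hs
  exact h.norm_diniQuotient_le hs

theorem integrable_diniQuotient (h : ArcControlled d c R x₀ M) :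
    Integrable (diniQuotient d c x₀) :=
  h.integrable_majorant.mono' h.measurable_diniQuotient.aestronglyMeasurable
    h.ae_norm_diniQuotient_le

theorem norm_truncatedFourierIntegral_le (h : ArcControlled d c R x₀ M) (a b : ℝ) :
    ‖truncatedFourierIntegral a b d x₀‖ ≤ 2 * Real.pi * ‖c‖ +
      2 * ((M / √R + ‖c‖ * R) * (∫ s, unitArcWeight s) +
        ‖c‖ * (√√(2 * R) / √√(R ^ 2 - x₀ ^ 2)) * ∫ x, gaussianPoleWeight x) := by
  refine (_root_.norm_truncatedFourierIntegral_le h.integrable h.integrable_diniQuotient a b).trans ?_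
  gcongr
  refine (integral_mono_ae h.integrable_diniQuotient.norm h.integrable_majorant
    h.ae_norm_diniQuotient_le).trans_eq ?_
  have hR := h.radius_pos
  have hsR : 0 < √R := Real.sqrt_pos.2 hR
  rw [integral_add ((integrable_arcWeight hR).const_mul _)
    ((integrable_gaussianPoleWeight.comp_sub_right x₀).const_mul _), integral_const_mul,
    integral_const_mul, integral_arcWeight hR, integral_sub_right_eq_self gaussianPoleWeight x₀]
  congr 1
  field_simp

end ArcControlled

/-! ### Densities on frequency circles -/

/-- The function `s ↦ E (s, y) / y` on the upper half of the circle `s² + y² = R²`. -/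
noncomputable def arcDensity (R : ℝ) (E : ℝ × ℝ → ℂ) (s : ℝ) : ℂ :=
  (Set.Ioo (-R) R).indicator
    (fun s => E (s, √(R ^ 2 - s ^ 2)) / ((√(R ^ 2 - s ^ 2) : ℝ) : ℂ)) s

theorem measurable_arcDensity {E : ℝ × ℝ → ℂ} (hE : Continuous E) (R : ℝ) :
    Measurable (arcDensity R E) :=
  Measurable.indicator ((hE.comp (by fun_prop : Continuous fun s : ℝ =>
    (s, √(R ^ 2 - s ^ 2)))).measurable.div (by fun_prop)) measurableSet_Ioo

theorem abs_sqrt_sub_mul_le {R s x y η : ℝ} (hs : s ∈ Set.Ioo (-R) R)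
    (hx : x ∈ Set.Ioo (-R) R) (hy : 0 < y) (hη : 0 < η) (hy2 : y ^ 2 = R ^ 2 - s ^ 2)
    (hη2 : η ^ 2 = R ^ 2 - x ^ 2) : |y - η| * (y + η) ≤ 2 * R * |s - x| := by
  have h1 : |y - η| * (y + η) = |s + x| * |s - x| := by
    rw [← abs_of_pos (add_pos hy hη), ← abs_mul, ← abs_mul, abs_eq_abs]
    right
    linear_combination hy2 - hη2
  rw [h1]
  refine mul_le_mul_of_nonneg_right ?_ (abs_nonneg _)
  rw [abs_le]
  constructor <;> linarith [hs.1, hs.2, hx.1, hx.2]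

/-- The delicate term is |y-η|/y, where |y-η|(y+η) ≤ 2R|s-x|. Replacing y+η by its lower bound √y√η
leaves y^{-3/2} = (R²-s²)^{-3/4}, integrable in s, at the price of η^{-1/2}, which will be
integrable in frequency. Using y alone would give y^{-2}, and η alone η^{-1}; neither is integrable
in its own variable. -/
theorem arcControlled_const_mul_arcDensity {E : ℝ × ℝ → ℂ} (hE : Continuous E) {R x η B : ℝ}
    (hx : x ∈ Set.Ioo (-R) R) (hη : 0 < η) (hη2 : η ^ 2 = R ^ 2 - x ^ 2) (hB : 0 ≤ B)
    (hb : ‖E (x, η)‖ ≤ B)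
    (hl : ∀ s y, s ^ 2 + y ^ 2 = R ^ 2 → ‖E (s, y) - E (x, η)‖ ≤ B * (|s - x| + |y - η|)) :
    ArcControlled (fun s => (η : ℂ) * arcDensity R E s) (E (x, η)) R x
      (B * (3 * R * √R + 2 * R / √η)) where
  measurable := (measurable_arcDensity hE R).const_mul _
  mem := hx
  nonneg := by
    have : 0 < R := by linarith [hx.1, hx.2]
    positivity
  eq_zero s hs := by simp [arcDensity, Set.indicator_of_notMem hs]
  bound s hs _ := by
    have hR : 0 < R := by linarith [hx.1, hx.2]
    have hpos : 0 < R ^ 2 - s ^ 2 := by nlinarith [hs.1, hs.2]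
    rw [arcDensity, arcWeight, Set.indicator_of_mem hs, Set.indicator_of_mem hs]
    set y := √(R ^ 2 - s ^ 2) with hydef
    have hy : 0 < y := Real.sqrt_pos.2 hpos
    have hy2 : y ^ 2 = R ^ 2 - s ^ 2 := Real.sq_sqrt hpos.le
    have hyR : y ≤ R := by nlinarith [sq_nonneg s]
    have hηR : η ≤ R := by nlinarith [sq_nonneg x]
    have hkey := abs_sqrt_sub_mul_le hs hx hy hη hy2 hη2
    have hl' := hl s y (by linarith)
    have hyc : (y : ℂ) ≠ 0 := by exact_mod_cast hy.ne'
    have hsplit : (η : ℂ) * (E (s, y) / (y : ℂ)) - E (x, η) =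
        ((η / y : ℝ) : ℂ) * (E (s, y) - E (x, η)) + ((-(y - η) / y : ℝ) : ℂ) * E (x, η) := by
      push_cast
      field_simp
      ring
    have hu : 0 < √y := Real.sqrt_pos.2 hy
    have hv : 0 < √η := Real.sqrt_pos.2 hη
    have hu2 : √y * √y = y := Real.mul_self_sqrt hy.le
    have hv2 : √η * √η = η := Real.mul_self_sqrt hη.le
    have huR : √y ≤ √R := Real.sqrt_le_sqrt hyR
    set t := |s - x| with ht
    have ht0 : 0 ≤ t := abs_nonneg _
    set z := |y - η| with hz
    have hz0 : 0 ≤ z := abs_nonneg _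
    -- One R comes from η ≤ R and two from η|y-η| ≤ (y+η)|y-η| ≤ 2R|s-x|.
    have h1 : η * (t + z) ≤ 3 * R * t := by
      have : η * z ≤ z * (y + η) := by nlinarith
      nlinarith
    have h2 : z * (√y * √η) ≤ 2 * R * t := by
      have : √y * √η ≤ y + η := by nlinarith [sq_nonneg (√y - √η)]
      exact (mul_le_mul_of_nonneg_left this hz0).trans hkey
    rw [hsplit]
    refine (norm_add_le _ _).trans ?_
    rw [norm_mul, norm_mul, Complex.norm_real, Complex.norm_real, Real.norm_of_nonneg (by positivity),
      Real.norm_eq_abs, abs_div, abs_neg, abs_of_pos hy, ← hz]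
    have h3 : η / y * ‖E (s, y) - E (x, η)‖ ≤ B * (3 * R * √R) * (1 / (y * √y)) * t := by
      calc η / y * ‖E (s, y) - E (x, η)‖ ≤ η / y * (B * (t + z)) := by gcongr
        _ = B * (η * (t + z)) * √y / (y * √y) := by field_simp
        _ ≤ B * (3 * R * t) * √R / (y * √y) := by gcongr
        _ = _ := by ring
    have h4 : z / y * ‖E (x, η)‖ ≤ B * (2 * R / √η) * (1 / (y * √y)) * t := by
      calc z / y * ‖E (x, η)‖ ≤ z / y * B := by gcongr
        _ = B * (z * (√y * √η)) / √η / (y * √y) := by field_simp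
        _ ≤ B * (2 * R * t) / √η / (y * √y) := by gcongr
        _ = _ := by ring
    refine (add_le_add h3 h4).trans_eq ?_
    ring

/-- The factor y² of E cancels the 1/y of the density and leaves y·e(s,y), so no negative power of η
enters. The remaining error is of order 1/y at worst, and is weakened to the weight y^{-3/2} by
means of √y ≤ √R. -/
theorem arcControlled_arcDensity_sq_mul {E e : ℝ × ℝ → ℂ} (hE : Continuous E)
    (hEe : ∀ x, E x = (x.2 : ℂ) ^ 2 * e x) {R x η B : ℝ}
    (hx : x ∈ Set.Ioo (-R) R) (hη : 0 < η) (hη2 : η ^ 2 = R ^ 2 - x ^ 2) (hB : 0 ≤ B)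
    (hb : ‖e (x, η)‖ ≤ B)
    (hl : ∀ s y, s ^ 2 + y ^ 2 = R ^ 2 → ‖e (s, y) - e (x, η)‖ ≤ B * (|s - x| + |y - η|)) :
    ArcControlled (arcDensity R E) ((η : ℂ) * e (x, η)) R x
      (B * (3 * R ^ 2 * √R + 2 * R * √R)) where
  measurable := measurable_arcDensity hE R
  mem := hx
  nonneg := by
    have : 0 < R := by linarith [hx.1, hx.2]
    positivity
  eq_zero s hs := by simp [arcDensity, Set.indicator_of_notMem hs]
  bound s hs _ := by
    have hR : 0 < R := by linarith [hx.1, hx.2]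
    have hpos : 0 < R ^ 2 - s ^ 2 := by nlinarith [hs.1, hs.2]
    rw [arcDensity, arcWeight, Set.indicator_of_mem hs, Set.indicator_of_mem hs]
    set y := √(R ^ 2 - s ^ 2) with hydef
    have hy : 0 < y := Real.sqrt_pos.2 hpos
    have hy2 : y ^ 2 = R ^ 2 - s ^ 2 := Real.sq_sqrt hpos.le
    have hyR : y ≤ R := by nlinarith [sq_nonneg s]
    have hkey := abs_sqrt_sub_mul_le hs hx hy hη hy2 hη2
    have hl' := hl s y (by linarith)
    have hyc : (y : ℂ) ≠ 0 := by exact_mod_cast hy.ne'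
    have hsplit : E (s, y) / (y : ℂ) - (η : ℂ) * e (x, η) =
        (y : ℂ) * (e (s, y) - e (x, η)) + ((y - η : ℝ) : ℂ) * e (x, η) := by
      rw [hEe]
      push_cast
      field_simp
      ring
    have hu : 0 < √y := Real.sqrt_pos.2 hy
    have huR : √y ≤ √R := Real.sqrt_le_sqrt hyR
    set t := |s - x| with ht
    have ht0 : 0 ≤ t := abs_nonneg _
    set z := |y - η| with hz
    have hz0 : 0 ≤ z := abs_nonneg _
    have hzy : y * z ≤ 2 * R * t := by nlinarith
    have h1 : y * (t + z) ≤ 3 * R * t := by nlinarith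
    rw [hsplit]
    refine (norm_add_le _ _).trans ?_
    rw [norm_mul, norm_mul, Complex.norm_real, Complex.norm_real, Real.norm_of_nonneg hy.le,
      Real.norm_eq_abs, ← hz]
    have h3 : y * ‖e (s, y) - e (x, η)‖ ≤ B * (3 * R ^ 2 * √R) * (1 / (y * √y)) * t := by
      calc y * ‖e (s, y) - e (x, η)‖ ≤ y * (B * (t + z)) := by gcongr
        _ = B * (y * (t + z)) * y * √y / (y * √y) := by field_simp
        _ ≤ B * (3 * R * t) * R * √R / (y * √y) := by gcongr
        _ = _ := by ring
    have h4 : z * ‖e (x, η)‖ ≤ B * (2 * R * √R) * (1 / (y * √y)) * t := by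
      calc z * ‖e (x, η)‖ ≤ z * B := by gcongr
        _ = B * (y * z) * √y / (y * √y) := by field_simp
        _ ≤ B * (2 * R * t) * √R / (y * √y) := by gcongr
        _ = _ := by ring
    refine (add_le_add h3 h4).trans_eq ?_
    ring

/-! ### Bounds in frequency space uniform in the truncation -/

/-- An integrable function dominating the Fourier transforms of the truncated back-projections. -/
noncomputable def frequencyMajorant (ξ : ℝ × ℝ) : ℝ :=
  1 / (1 + ξ.1 ^ 2) * ((1 + 1 / √|ξ.2|) / (1 + ξ.2 ^ 2))

theorem integrable_frequencyMajorant : Integrable frequencyMajorant := by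
  have h1 : Integrable fun x : ℝ => 1 / (1 + x ^ 2) := by
    simpa only [one_div] using integrable_inv_one_add_sq
  have h2 : Integrable fun x : ℝ => (1 + 1 / √|x|) / (1 + x ^ 2) := by
    have h3 : IntegrableOn (fun x : ℝ => 1 / √x / (1 + x ^ 2)) (Set.Ioi 0) := by
      rw [← Set.Ioc_union_Ioi_eq_Ioi zero_le_one]
      refine IntegrableOn.union ?_ ?_
      · have h := (intervalIntegral.intervalIntegrable_rpow' (a := 0) (b := 1) (r := -(1 / 2))
          (by norm_num))
        rw [intervalIntegrable_iff_integrableOn_Ioc_of_le zero_le_one] at h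
        refine h.mono' (Measurable.aestronglyMeasurable (by fun_prop)) ?_
        refine (ae_restrict_iff' measurableSet_Ioc).2 (Eventually.of_forall fun x hx => ?_)
        rw [Real.norm_of_nonneg (by positivity), Real.rpow_neg hx.1.le, ← Real.sqrt_eq_rpow,
          ← one_div]
        exact div_le_self (by positivity) (by nlinarith [sq_nonneg x])
      · refine h1.integrableOn.mono' (Measurable.aestronglyMeasurable (by fun_prop)) ?_
        refine (ae_restrict_iff' measurableSet_Ioi).2 (Eventually.of_forall fun x hx => ?_)
        have hx1 : (1 : ℝ) ≤ x := le_of_lt hx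
        rw [Real.norm_of_nonneg (by positivity)]
        have : 1 / √x ≤ 1 := by
          rw [div_le_one (by positivity)]
          exact Real.one_le_sqrt.2 hx1
        gcongr
    refine (h1.add (integrable_comp_abs_of_integrableOn_Ioi h3)).congr
      (Eventually.of_forall fun x => ?_)
    simp only [Pi.add_apply, sq_abs]
    ring
  exact h1.mul_prod h2

/-- Rapid decay of order three, together with the corresponding Lipschitz bound on circles. -/
structure CircleDecay (E : ℝ × ℝ → ℂ) (C : ℝ) : Prop where
  continuous : Continuous E
  nonneg : 0 ≤ C
  bound : ∀ ξ : ℝ × ℝ, ‖E ξ‖ ≤ C / (1 + ξ.1 ^ 2 + ξ.2 ^ 2) ^ 3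
  lipschitz : ∀ ξ η : ℝ × ℝ, ξ.1 ^ 2 + ξ.2 ^ 2 = η.1 ^ 2 + η.2 ^ 2 →
    ‖E ξ - E η‖ ≤ C / (1 + ξ.1 ^ 2 + ξ.2 ^ 2) ^ 3 * (|ξ.1 - η.1| + |ξ.2 - η.2|)

theorem exists_circleDecay_planeFourier {G : ℝ × ℝ → ℂ} (hG : ContDiff ℝ ∞ G)
    (hc : HasCompactSupport G) : ∃ C, CircleDecay (planeFourier G) C := by
  obtain ⟨C, h0, h1, h2⟩ := exists_planeFourier_decay hG hc 3
  exact ⟨C, continuous_planeFourier (hG.continuous.integrable_of_hasCompactSupport hc), h0, h1, h2⟩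

theorem sqrt_sqrt_two_mul_le (R : ℝ) : √√(2 * R) ≤ √(1 + R ^ 2) := by
  refine Real.sqrt_le_sqrt ?_
  rw [Real.sqrt_le_left (by positivity)]
  nlinarith [sq_nonneg (R - 1), sq_nonneg R]

/-- Of the three powers of 1+|ξ|², one pays for the growth 1+R² of the Dini bound; the other two
dominate the product (1+ξ₁²)(1+ξ₂²). -/
theorem div_bracket_mul_le {K η R : ℝ} {ξ : ℝ × ℝ} (hK : 0 ≤ K) (hη : η = |ξ.2|)
    (hR : R ^ 2 = ξ.1 ^ 2 + ξ.2 ^ 2) :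
    K / (1 + ξ.1 ^ 2 + ξ.2 ^ 2) ^ 3 * ((1 + R ^ 2) * (1 + 1 / √η)) ≤ K * frequencyMajorant ξ := by
  rw [frequencyMajorant, ← hη, show 1 + R ^ 2 = 1 + ξ.1 ^ 2 + ξ.2 ^ 2 by rw [hR]; ring]
  have h1 : (1 + ξ.1 ^ 2) * (1 + ξ.2 ^ 2) ≤ (1 + ξ.1 ^ 2 + ξ.2 ^ 2) ^ 2 := by
    nlinarith [sq_nonneg ξ.1, sq_nonneg ξ.2, mul_nonneg (sq_nonneg ξ.1) (sq_nonneg ξ.2)]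
  have h2 : 0 < 1 + ξ.1 ^ 2 + ξ.2 ^ 2 := by positivity
  calc K / (1 + ξ.1 ^ 2 + ξ.2 ^ 2) ^ 3 * ((1 + ξ.1 ^ 2 + ξ.2 ^ 2) * (1 + 1 / √η))
      = K * (1 + 1 / √η) / (1 + ξ.1 ^ 2 + ξ.2 ^ 2) ^ 2 := by field_simp
    _ ≤ K * (1 + 1 / √η) / ((1 + ξ.1 ^ 2) * (1 + ξ.2 ^ 2)) := by gcongr
    _ = _ := by field_simp

theorem truncatedFourierIntegral_const_mul (a b : ℝ) (k : ℂ) (d : ℝ → ℂ) (x₀ : ℝ) :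
    truncatedFourierIntegral a b (fun s => k * d s) x₀ = k * truncatedFourierIntegral a b d x₀ := by
  simp only [truncatedFourierIntegral]
  rw [← integral_const_mul]
  refine integral_congr_ae (Eventually.of_forall fun p => ?_)
  simp only
  rw [← integral_const_mul]
  refine integral_congr_ae (Eventually.of_forall fun s => ?_)
  simp only
  ring

/-- The truncated Fourier integral at `ξ₁` of the density of `E` on the circle through `ξ`. -/
noncomputable def circleTransform (a b : ℝ) (E : ℝ × ℝ → ℂ) (ξ : ℝ × ℝ) : ℂ :=
  truncatedFourierIntegral a b (arcDensity (√(ξ.1 ^ 2 + ξ.2 ^ 2)) E) ξ.1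

theorem mem_Ioo_sqrt {ξ : ℝ × ℝ} (h : ξ.2 ≠ 0) :
    ξ.1 ∈ Set.Ioo (-√(ξ.1 ^ 2 + ξ.2 ^ 2)) (√(ξ.1 ^ 2 + ξ.2 ^ 2)) := by
  rw [Set.mem_Ioo, ← abs_lt, ← Real.sqrt_sq_eq_abs]
  have : 0 < ξ.2 ^ 2 := by positivity
  exact Real.sqrt_lt_sqrt (sq_nonneg _) (by linarith)

/-- Dini's test at s = ξ₁ on the circle of radius R = |ξ|, applied to |ξ₂| times the density, whose
value there is E(ξ₁,|ξ₂|). The loss η^{-1/2} with η = |ξ₂| arises both from the density and from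
(R²-ξ₁²)^{-1/4}. -/
theorem CircleDecay.abs_mul_circleTransform {E : ℝ × ℝ → ℂ} {C : ℝ} (hE : CircleDecay E C) :
    (∃ K, ∀ ξ : ℝ × ℝ, ξ.2 ≠ 0 → ∀ a b : ℝ,
      ‖((|ξ.2| : ℝ) : ℂ) * circleTransform a b E ξ‖ ≤ K * frequencyMajorant ξ) ∧
    ∀ ξ : ℝ × ℝ, ξ.2 ≠ 0 →
      Tendsto (fun ab : ℝ × ℝ => ((|ξ.2| : ℝ) : ℂ) * circleTransform ab.1 ab.2 E ξ)
        (atTop ×ˢ atTop) (𝓝 (2 * Real.pi * E (ξ.1, |ξ.2|))) := by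
  have hctl : ∀ ξ : ℝ × ℝ, ξ.2 ≠ 0 → ArcControlled
      (fun s => ((|ξ.2| : ℝ) : ℂ) * arcDensity (√(ξ.1 ^ 2 + ξ.2 ^ 2)) E s) (E (ξ.1, |ξ.2|))
      (√(ξ.1 ^ 2 + ξ.2 ^ 2)) ξ.1 (C / (1 + ξ.1 ^ 2 + ξ.2 ^ 2) ^ 3 *
        (3 * √(ξ.1 ^ 2 + ξ.2 ^ 2) * √√(ξ.1 ^ 2 + ξ.2 ^ 2) +
          2 * √(ξ.1 ^ 2 + ξ.2 ^ 2) / √|ξ.2|)) := by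
    intro ξ hξ
    have hR2 : √(ξ.1 ^ 2 + ξ.2 ^ 2) ^ 2 = ξ.1 ^ 2 + ξ.2 ^ 2 := Real.sq_sqrt (by positivity)
    have hC := hE.nonneg
    refine arcControlled_const_mul_arcDensity hE.continuous (mem_Ioo_sqrt hξ) (abs_pos.2 hξ)
      (by rw [hR2, sq_abs]; ring) (by positivity) ?_ fun s y hsy => ?_
    · simpa using hE.bound (ξ.1, |ξ.2|)
    · rw [hR2] at hsy
      have h := hE.lipschitz (s, y) (ξ.1, |ξ.2|) (by simpa using hsy)
      rwa [show 1 + (s, y).1 ^ 2 + (s, y).2 ^ 2 = 1 + ξ.1 ^ 2 + ξ.2 ^ 2 by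
        simp only; linarith] at h
  -- The 12 is 2·(3+2+1): the terms 3R and 2√R/√η from the density and R from the Gaussian
  -- comparison, each bounded by a multiple of (1+R²)(1+1/√η), with the outer 2 from the two
  -- boundary terms.
  refine ⟨⟨C * (2 * Real.pi + 12 * (∫ s, unitArcWeight s) + 2 * ∫ x, gaussianPoleWeight x),
    fun ξ hξ a b => ?_⟩, fun ξ hξ => ?_⟩
  · have h := (hctl ξ hξ).norm_truncatedFourierIntegral_le a b
    rw [truncatedFourierIntegral_const_mul] at h
    refine h.trans ?_
    have hb : ‖E (ξ.1, |ξ.2|)‖ ≤ C / (1 + ξ.1 ^ 2 + ξ.2 ^ 2) ^ 3 := by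
      simpa using hE.bound (ξ.1, |ξ.2|)
    have hR0 := (hctl ξ hξ).radius_pos
    have hR2 : √(ξ.1 ^ 2 + ξ.2 ^ 2) ^ 2 = ξ.1 ^ 2 + ξ.2 ^ 2 := Real.sq_sqrt (by positivity)
    have hC := hE.nonneg
    have hK0 : 0 ≤ ∫ s, unitArcWeight s := integral_nonneg unitArcWeight_nonneg
    have hK1 : 0 ≤ ∫ x, gaussianPoleWeight x := integral_nonneg gaussianPoleWeight_nonneg
    refine le_trans ?_ (div_bracket_mul_le (R := √(ξ.1 ^ 2 + ξ.2 ^ 2)) (by positivity) rfl hR2)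
    set R := √(ξ.1 ^ 2 + ξ.2 ^ 2) with hR
    set K0 := ∫ s, unitArcWeight s
    set K1 := ∫ x, gaussianPoleWeight x
    have hη : 0 < |ξ.2| := abs_pos.2 hξ
    rw [show R ^ 2 - ξ.1 ^ 2 = |ξ.2| ^ 2 by rw [hR2, sq_abs]; ring, Real.sqrt_sq hη.le]
    set η := |ξ.2|
    have hsη : 0 < √η := Real.sqrt_pos.2 hη
    have hsR : 0 < √R := Real.sqrt_pos.2 hR0
    have hsR2 : √R * √R = R := Real.mul_self_sqrt hR0.le
    set B := C / (1 + ξ.1 ^ 2 + ξ.2 ^ 2) ^ 3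
    have hB : 0 ≤ B := by positivity
    set q := 1 / √η with hq
    have hq0 : 0 < q := by positivity
    have e1 : B * (3 * R * √R + 2 * R / √η) / √R = B * (3 * R + 2 * √R * q) := by
      rw [hq]
      field_simp
      linear_combination (-2 * B) * hsR2
    have e2 : √√(2 * R) / √η = √√(2 * R) * q := by rw [hq]; ring
    rw [e1, e2, show C * (2 * Real.pi + 12 * K0 + 2 * K1) / (1 + ξ.1 ^ 2 + ξ.2 ^ 2) ^ 3 =
      B * (2 * Real.pi + 12 * K0 + 2 * K1) by simp only [B]; ring]
    have f1 : R ≤ 1 + R ^ 2 := by nlinarith [sq_nonneg (R - 1)]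
    have f2 : √R ≤ 1 + R ^ 2 := by nlinarith [sq_nonneg (√R - 1)]
    have f3 : √√(2 * R) ≤ 1 + R ^ 2 := by
      refine (sqrt_sqrt_two_mul_le R).trans ?_
      rw [Real.sqrt_le_left (by positivity)]
      nlinarith [sq_nonneg R]
    set P := 1 + R ^ 2
    have hP : 1 ≤ P := by simp only [P]; nlinarith [sq_nonneg R]
    have hP0 : 0 ≤ P := by linarith
    calc 2 * Real.pi * ‖E (ξ.1, η)‖ + 2 * ((B * (3 * R + 2 * √R * q) + ‖E (ξ.1, η)‖ * R) * K0 +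
          ‖E (ξ.1, η)‖ * (√√(2 * R) * q) * K1)
        ≤ 2 * Real.pi * B + 2 * ((B * (3 * P + 2 * P * q) + B * P) * K0 + B * (P * q) * K1) := by
          gcongr
      _ ≤ 2 * Real.pi * (B * (P * (1 + q))) + 2 * ((B * (3 * (P * (1 + q)) + 2 * (P * (1 + q))) +
            B * (P * (1 + q))) * K0 + B * (P * (1 + q)) * K1) := by
          have g1 : P ≤ P * (1 + q) := by nlinarith
          have g2 : P * q ≤ P * (1 + q) := by nlinarith
          have g3 : 2 * P * q ≤ 2 * (P * (1 + q)) := by nlinarith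
          have g4 : B ≤ B * (P * (1 + q)) := by
            nlinarith
          gcongr
      _ = B * (2 * Real.pi + 12 * K0 + 2 * K1) * (P * (1 + q)) := by ring
  · have h := tendsto_truncatedFourierIntegral (hctl ξ hξ).integrable
      (hctl ξ hξ).integrable_diniQuotient
    simp only [truncatedFourierIntegral_const_mul] at h
    exact h

/-- The counterpart for a transform divisible by ξ₂²: domination now holds without the factor |ξ₂|,
so the back-projections themselves converge and not merely their filtered versions. -/
theorem CircleDecay.circleTransform_of_sq_mul {E e : ℝ × ℝ → ℂ} {C : ℝ} (he : CircleDecay e C)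
    (hE : Continuous E) (hEe : ∀ x, E x = (x.2 : ℂ) ^ 2 * e x) :
    (∃ K, ∀ ξ : ℝ × ℝ, ξ.2 ≠ 0 → ∀ a b : ℝ,
      ‖circleTransform a b E ξ‖ ≤ K * frequencyMajorant ξ) ∧
    ∀ ξ : ℝ × ℝ, ξ.2 ≠ 0 →
      Tendsto (fun ab : ℝ × ℝ => circleTransform ab.1 ab.2 E ξ)
        (atTop ×ˢ atTop) (𝓝 (2 * Real.pi * (((|ξ.2| : ℝ) : ℂ) * e (ξ.1, |ξ.2|)))) := by
  have hctl : ∀ ξ : ℝ × ℝ, ξ.2 ≠ 0 → ArcControlled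
      (arcDensity (√(ξ.1 ^ 2 + ξ.2 ^ 2)) E) (((|ξ.2| : ℝ) : ℂ) * e (ξ.1, |ξ.2|))
      (√(ξ.1 ^ 2 + ξ.2 ^ 2)) ξ.1 (C / (1 + ξ.1 ^ 2 + ξ.2 ^ 2) ^ 3 *
        (3 * √(ξ.1 ^ 2 + ξ.2 ^ 2) ^ 2 * √√(ξ.1 ^ 2 + ξ.2 ^ 2) +
          2 * √(ξ.1 ^ 2 + ξ.2 ^ 2) * √√(ξ.1 ^ 2 + ξ.2 ^ 2))) := by
    intro ξ hξ
    have hR2 : √(ξ.1 ^ 2 + ξ.2 ^ 2) ^ 2 = ξ.1 ^ 2 + ξ.2 ^ 2 := Real.sq_sqrt (by positivity)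
    have hC := he.nonneg
    refine arcControlled_arcDensity_sq_mul hE hEe (mem_Ioo_sqrt hξ) (abs_pos.2 hξ)
      (by rw [hR2, sq_abs]; ring) (by positivity) ?_ fun s y hsy => ?_
    · simpa using he.bound (ξ.1, |ξ.2|)
    · rw [hR2] at hsy
      have h := he.lipschitz (s, y) (ξ.1, |ξ.2|) (by simpa using hsy)
      rwa [show 1 + (s, y).1 ^ 2 + (s, y).2 ^ 2 = 1 + ξ.1 ^ 2 + ξ.2 ^ 2 by
        simp only; linarith] at h
  refine ⟨⟨C * (2 * Real.pi + 12 * (∫ s, unitArcWeight s) + 2 * ∫ x, gaussianPoleWeight x),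
    fun ξ hξ a b => ?_⟩, fun ξ hξ =>
      tendsto_truncatedFourierIntegral (hctl ξ hξ).integrable (hctl ξ hξ).integrable_diniQuotient⟩
  refine ((hctl ξ hξ).norm_truncatedFourierIntegral_le a b).trans ?_
  have hb : ‖e (ξ.1, |ξ.2|)‖ ≤ C / (1 + ξ.1 ^ 2 + ξ.2 ^ 2) ^ 3 := by
    simpa using he.bound (ξ.1, |ξ.2|)
  have hR0 := (hctl ξ hξ).radius_pos
  have hR2 : √(ξ.1 ^ 2 + ξ.2 ^ 2) ^ 2 = ξ.1 ^ 2 + ξ.2 ^ 2 := Real.sq_sqrt (by positivity)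
  have hC := he.nonneg
  have hK0 : 0 ≤ ∫ s, unitArcWeight s := integral_nonneg unitArcWeight_nonneg
  have hK1 : 0 ≤ ∫ x, gaussianPoleWeight x := integral_nonneg gaussianPoleWeight_nonneg
  refine le_trans ?_ (div_bracket_mul_le (R := √(ξ.1 ^ 2 + ξ.2 ^ 2)) (by positivity) rfl hR2)
  set R := √(ξ.1 ^ 2 + ξ.2 ^ 2) with hR
  set K0 := ∫ s, unitArcWeight s
  set K1 := ∫ x, gaussianPoleWeight x
  have hη : 0 < |ξ.2| := abs_pos.2 hξ
  have hηR : |ξ.2| ≤ R := by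
    rw [hR, ← Real.sqrt_sq_eq_abs]
    exact Real.sqrt_le_sqrt (by linarith [sq_nonneg ξ.1])
  rw [show R ^ 2 - ξ.1 ^ 2 = |ξ.2| ^ 2 by rw [hR2, sq_abs]; ring, Real.sqrt_sq hη.le]
  rw [norm_mul, Complex.norm_real, Real.norm_of_nonneg hη.le]
  set η := |ξ.2|
  have hsη : 0 < √η := Real.sqrt_pos.2 hη
  have hsη2 : √η * √η = η := Real.mul_self_sqrt hη.le
  have hsR : 0 < √R := Real.sqrt_pos.2 hR0
  set B := C / (1 + ξ.1 ^ 2 + ξ.2 ^ 2) ^ 3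
  have hB : 0 ≤ B := by positivity
  have e1 : B * (3 * R ^ 2 * √R + 2 * R * √R) / √R = B * (3 * R ^ 2 + 2 * R) := by
    field_simp
  have e2 : η * ‖e (ξ.1, η)‖ * (√√(2 * R) / √η) = ‖e (ξ.1, η)‖ * (√η * √√(2 * R)) := by
    field_simp
    linear_combination (-‖e (ξ.1, η)‖) * hsη2
  rw [e1, e2, show C * (2 * Real.pi + 12 * K0 + 2 * K1) / (1 + ξ.1 ^ 2 + ξ.2 ^ 2) ^ 3 =
    B * (2 * Real.pi + 12 * K0 + 2 * K1) by simp only [B]; ring]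
  have f1 : R ≤ 1 + R ^ 2 := by nlinarith [sq_nonneg (R - 1)]
  have f2 : √η * √√(2 * R) ≤ 1 + R ^ 2 := by
    have g1 : √η ≤ √(1 + R ^ 2) := Real.sqrt_le_sqrt (by linarith)
    calc √η * √√(2 * R) ≤ √(1 + R ^ 2) * √(1 + R ^ 2) :=
          mul_le_mul g1 (sqrt_sqrt_two_mul_le R) (by positivity) (by positivity)
      _ = 1 + R ^ 2 := Real.mul_self_sqrt (by positivity)
  have f3 : η * R ≤ 1 + R ^ 2 := by nlinarith
  have f4 : R ^ 2 ≤ 1 + R ^ 2 := by linarith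
  set P := 1 + R ^ 2
  have hq : 1 ≤ 1 + 1 / √η := by
    have : 0 < 1 / √η := by positivity
    linarith
  have hP0 : 0 ≤ P := hR0.le.trans f1
  calc 2 * Real.pi * (η * ‖e (ξ.1, η)‖) + 2 * ((B * (3 * R ^ 2 + 2 * R) +
          η * ‖e (ξ.1, η)‖ * R) * K0 + ‖e (ξ.1, η)‖ * (√η * √√(2 * R)) * K1)
      = 2 * Real.pi * (η * ‖e (ξ.1, η)‖) + 2 * ((B * (3 * R ^ 2 + 2 * R) +
          ‖e (ξ.1, η)‖ * (η * R)) * K0 + ‖e (ξ.1, η)‖ * (√η * √√(2 * R)) * K1) := by ring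
    _ ≤ 2 * Real.pi * (P * B) + 2 * ((B * (3 * P + 2 * P) + B * P) * K0 + B * P * K1) := by
        have f5 : η ≤ P := hηR.trans f1
        gcongr
    _ = B * (2 * Real.pi + 12 * K0 + 2 * K1) * (P * 1) := by ring
    _ ≤ B * (2 * Real.pi + 12 * K0 + 2 * K1) * (P * (1 + 1 / √η)) := by gcongr

/-! ### Integrals over circles and rotations about points of the axis -/

/-- Starting the circle at the angle of (x,y) instead of at 0 only shifts a periodic integrand. -/
theorem integral_circle_rotate (Φ : ℝ → ℝ → ℂ) (x y : ℝ) :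
    ∫ β in (0 : ℝ)..(2 * Real.pi), Φ (√(x ^ 2 + y ^ 2) * Real.cos β) (√(x ^ 2 + y ^ 2) * Real.sin β) =
      ∫ β in (0 : ℝ)..(2 * Real.pi),
        Φ (x * Real.cos β - y * Real.sin β) (x * Real.sin β + y * Real.cos β) := by
  set r := √(x ^ 2 + y ^ 2) with hr
  set γ := Complex.arg ⟨x, y⟩
  have hn : ‖(⟨x, y⟩ : ℂ)‖ = r := by
    rw [Complex.norm_def, Complex.normSq_mk, hr]
    congr 1
    ring
  have hx : r * Real.cos γ = x := by
    rw [← hn]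
    exact Complex.norm_mul_cos_arg _
  have hy : r * Real.sin γ = y := by
    rw [← hn]
    exact Complex.norm_mul_sin_arg _
  set ψ : ℝ → ℂ := fun β => Φ (r * Real.cos β) (r * Real.sin β) with hψ
  have hper : Function.Periodic ψ (2 * Real.pi) := fun β => by
    simp only [hψ, Real.cos_add_two_pi, Real.sin_add_two_pi]
  have h1 : ∀ β, Φ (x * Real.cos β - y * Real.sin β) (x * Real.sin β + y * Real.cos β) = ψ (β + γ) := by
    intro β
    simp only [hψ, Real.cos_add, Real.sin_add]
    rw [← hx, ← hy]
    congr 1 <;> ring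
  simp only [h1]
  rw [intervalIntegral.integral_comp_add_right, add_comm (2 * Real.pi)]
  have := hper.intervalIntegral_add_eq 0 (0 + γ)
  rw [zero_add, zero_add] at this
  rw [zero_add]
  exact this

theorem integral_circle_eq_two_mul {ψ : ℝ → ℂ} (hψ : Continuous ψ)
    (hper : Function.Periodic ψ (2 * Real.pi)) (heven : ∀ β, ψ (-β) = ψ β) :
    ∫ β in (0 : ℝ)..(2 * Real.pi), ψ β = 2 * ∫ β in (0 : ℝ)..Real.pi, ψ β := by
  have h1 := hper.intervalIntegral_add_eq 0 (-Real.pi)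
  rw [zero_add, show -Real.pi + 2 * Real.pi = Real.pi by ring] at h1
  rw [h1, ← intervalIntegral.integral_add_adjacent_intervals (b := 0)
    (hψ.intervalIntegrable _ _) (hψ.intervalIntegrable _ _), two_mul]
  congr 1
  have h2 := intervalIntegral.integral_comp_neg (f := ψ) (a := 0) (b := Real.pi)
  rw [neg_zero] at h2
  rw [← h2]
  simp only [heven]

/-- Substitute s = R cos β; the Jacobian R sin β is the denominator. -/
theorem integral_Ioo_div_sqrt {R : ℝ} (hR : 0 < R) (Φ : ℝ → ℝ → ℂ) :
    ∫ s in Set.Ioo (-R) R, Φ s (√(R ^ 2 - s ^ 2)) / ((√(R ^ 2 - s ^ 2) : ℝ) : ℂ) =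
      ∫ β in (0 : ℝ)..Real.pi, Φ (R * Real.cos β) (R * Real.sin β) := by
  have himg : (fun β => R * Real.cos β) '' Set.Ioo 0 Real.pi = Set.Ioo (-R) R := by
    ext s
    constructor
    · rintro ⟨β, hβ, rfl⟩
      have h1 := Real.sin_pos_of_mem_Ioo hβ
      have h2 : |Real.cos β| < 1 := by
        rw [← sq_lt_one_iff_abs_lt_one]
        nlinarith [Real.sin_sq_add_cos_sq β]
      rw [abs_lt] at h2
      constructor <;> nlinarith [h2.1, h2.2]
    · intro hs
      have h1 : -1 < s / R := by rw [lt_div_iff₀ hR]; linarith [hs.1]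
      have h2 : s / R < 1 := by rw [div_lt_iff₀ hR]; linarith [hs.2]
      refine ⟨Real.arccos (s / R), ⟨Real.arccos_pos.2 h2, ?_⟩, ?_⟩
      · refine lt_of_le_of_ne (Real.arccos_le_pi _) fun h => ?_
        rw [Real.arccos_eq_pi] at h
        linarith
      · simp only [Real.cos_arccos h1.le h2.le]
        field_simp
  rw [← himg, integral_image_eq_integral_abs_deriv_smul measurableSet_Ioo
    (f' := fun β => R * -Real.sin β)
    (fun β _ => ((Real.hasDerivAt_cos β).const_mul R).hasDerivWithinAt)
    (fun a ha b hb hab => Real.injOn_cos ⟨ha.1.le, ha.2.le⟩ ⟨hb.1.le, hb.2.le⟩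
      (mul_left_cancel₀ hR.ne' hab)),
    intervalIntegral.integral_of_le Real.pi_pos.le, integral_Ioc_eq_integral_Ioo]
  refine setIntegral_congr_fun measurableSet_Ioo fun β hβ => ?_
  have h1 := Real.sin_pos_of_mem_Ioo hβ
  have h2 : √(R ^ 2 - (R * Real.cos β) ^ 2) = R * Real.sin β := by
    rw [show R ^ 2 - (R * Real.cos β) ^ 2 = (R * Real.sin β) ^ 2 by
      linear_combination R ^ 2 * (Real.sin_sq_add_cos_sq β).symm]
    exact Real.sqrt_sq (by positivity)
  have h3 : ((R * Real.sin β : ℝ) : ℂ) ≠ 0 := by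
    exact_mod_cast (mul_pos hR h1).ne'
  simp only [h2]
  rw [mul_neg, abs_neg, abs_of_pos (mul_pos hR h1), Complex.real_smul, mul_div_cancel₀ _ h3]

/-- The rigid motion of the `(z, t)`-plane that rotates by `β` about the point `(p, 0)`. -/
noncomputable def axisRotation (p β : ℝ) (x : ℝ × ℝ) : ℝ × ℝ :=
  (p + (x.1 - p) * Real.cos β + x.2 * Real.sin β, x.2 * Real.cos β - (x.1 - p) * Real.sin β)

theorem continuous_axisRotation :
    Continuous fun y : (ℝ × ℝ) × ℝ × ℝ => axisRotation y.2.1 y.2.2 y.1 := by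
  unfold axisRotation
  fun_prop

theorem axisRotation_neg (p β : ℝ) (x : ℝ × ℝ) :
    axisRotation p (-β) (axisRotation p β x) = x := by
  have h := Real.sin_sq_add_cos_sq β
  ext
  · simp only [axisRotation, Real.cos_neg, Real.sin_neg]
    linear_combination (x.1 - p) * h
  · simp only [axisRotation, Real.cos_neg, Real.sin_neg]
    linear_combination x.2 * h

theorem measurePreserving_axisRotation (p β : ℝ) :
    MeasurePreserving (axisRotation p β) volume volume := by
  set M : ℝ × ℝ →ₗ[ℝ] ℝ × ℝ := Matrix.toLin (Module.Basis.finTwoProd ℝ) (Module.Basis.finTwoProd ℝ)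
    !![Real.cos β, Real.sin β; -Real.sin β, Real.cos β] with hM
  have hdet : LinearMap.det M = 1 := by
    rw [hM, LinearMap.det_toLin, Matrix.det_fin_two_of]
    linear_combination Real.sin_sq_add_cos_sq β
  have hMp : MeasurePreserving M volume volume := by
    refine ⟨M.continuous_of_finiteDimensional.measurable, ?_⟩
    rw [Measure.map_linearMap_addHaar_eq_smul_addHaar _ (by rw [hdet]; exact one_ne_zero), hdet]
    simp
  have h := (measurePreserving_add_left (volume : Measure (ℝ × ℝ))
    (p - p * Real.cos β, p * Real.sin β)).comp hMp
  convert h using 1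
  funext x
  simp only [axisRotation, Function.comp, hM, Matrix.toLin_finTwoProd_apply, Prod.mk_add_mk]
  ext <;> simp only <;> ring

/-! ### The Fourier transform of the truncated back-projection -/

section Circle

variable {H : ℝ × ℝ → ℂ}

/-- Half the mean of `H` over the circle centred at `(p, 0)` through `x`. -/
noncomputable def axisMean (H : ℝ × ℝ → ℂ) (p : ℝ) (x : ℝ × ℝ) : ℂ :=
  (1 / (4 * (Real.pi : ℂ))) * ∫ β in (0 : ℝ)..(2 * Real.pi), H (axisRotation p β x)

/-- The back-projection of the means with centres `p ∈ [-a, b]`. -/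
noncomputable def axisBackProjection (a b : ℝ) (H : ℝ × ℝ → ℂ) (x : ℝ × ℝ) : ℂ :=
  ∫ p in Set.Icc (-a) b, axisMean H p x

theorem continuous_axisMean (hH : Continuous H) :
    Continuous fun y : ℝ × ℝ × ℝ => axisMean H y.1 y.2 := by
  refine continuous_const.mul
    (intervalIntegral.continuous_parametric_intervalIntegral_of_continuous' ?_ _ _)
  refine hH.comp ?_
  simp only [axisRotation]
  fun_prop

/-- K is swept out by rotating the support back about the centres in [-a,b]. Reducing the angle
modulo 2π makes the parameter set compact. -/
theorem exists_axisRotation_bound (hc : HasCompactSupport H) (a b : ℝ) :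
    ∃ K : Set (ℝ × ℝ), IsCompact K ∧ ∀ x ∉ K, ∀ p ∈ Set.Icc (-a) b, ∀ β,
      H (axisRotation p β x) = 0 := by
  set S := tsupport H
  have hS : IsCompact S := hc
  set g : (ℝ × ℝ) × ℝ × ℝ → ℝ × ℝ := fun y => axisRotation y.2.1 y.2.2 y.1
  refine ⟨g '' (S ×ˢ (Set.Icc (-a) b ×ˢ Set.Icc (-Real.pi) Real.pi)),
    (hS.prod (isCompact_Icc.prod isCompact_Icc)).image continuous_axisRotation, ?_⟩
  intro x hx p hp β
  by_contra hne
  refine hx ⟨(axisRotation p β x, p, toIocMod Real.two_pi_pos (-Real.pi) (-β)),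
    ⟨subset_tsupport H hne, hp, ?_⟩, ?_⟩
  · have := toIocMod_mem_Ioc Real.two_pi_pos (-Real.pi) (-β)
    rw [show -Real.pi + 2 * Real.pi = Real.pi by ring] at this
    exact Set.Ioc_subset_Icc_self this
  · simp only [g]
    have hmod : axisRotation p (toIocMod Real.two_pi_pos (-Real.pi) (-β)) =
        axisRotation p (-β) := by
      funext w
      rw [toIocMod, zsmul_eq_mul]
      simp only [axisRotation, Real.cos_sub_int_mul_two_pi, Real.sin_sub_int_mul_two_pi]
    rw [hmod, axisRotation_neg]

theorem integrable_axisRotation (hH : Continuous H) (hc : HasCompactSupport H) (a b : ℝ) :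
    Integrable (fun y : (ℝ × ℝ) × ℝ × ℝ => H (axisRotation y.2.1 y.2.2 y.1))
      ((volume : Measure (ℝ × ℝ)).prod
        ((volume.restrict (Set.Icc (-a) b)).prod (volume.restrict (Set.Ioc 0 (2 * Real.pi))))) := by
  obtain ⟨K, hK, hKz⟩ := exists_axisRotation_bound hc a b
  have hcont : Continuous fun y : (ℝ × ℝ) × ℝ × ℝ => H (axisRotation y.2.1 y.2.2 y.1) :=
    hH.comp continuous_axisRotation
  have h1 : IntegrableOn (fun y : (ℝ × ℝ) × ℝ × ℝ => H (axisRotation y.2.1 y.2.2 y.1))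
      (K ×ˢ (Set.Icc (-a) b ×ˢ Set.Icc 0 (2 * Real.pi))) volume :=
    hcont.continuousOn.integrableOn_compact (hK.prod (isCompact_Icc.prod isCompact_Icc))
  have h2 : IntegrableOn (fun y : (ℝ × ℝ) × ℝ × ℝ => H (axisRotation y.2.1 y.2.2 y.1))
      (Set.univ ×ˢ (Set.Icc (-a) b ×ˢ Set.Ioc 0 (2 * Real.pi))) volume := by
    refine h1.of_forall_sdiff_eq_zero
      (MeasurableSet.univ.prod (measurableSet_Icc.prod measurableSet_Ioc)) ?_
    rintro ⟨x, p, β⟩ ⟨⟨_, hp, hβ⟩, hnot⟩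
    refine hKz x (fun hxK => hnot ⟨hxK, hp, Set.Ioc_subset_Icc_self hβ⟩) p hp β
  rw [IntegrableOn, Measure.volume_eq_prod, ← Measure.prod_restrict, Measure.restrict_univ,
    Measure.volume_eq_prod ℝ ℝ, ← Measure.prod_restrict] at h2
  exact h2

theorem axisBackProjection_eq (hH : Continuous H) (a b : ℝ) (x : ℝ × ℝ) :
    axisBackProjection a b H x = (1 / (4 * (Real.pi : ℂ))) *
      ∫ w, H (axisRotation w.1 w.2 x)
        ∂((volume.restrict (Set.Icc (-a) b)).prod (volume.restrict (Set.Ioc 0 (2 * Real.pi)))) := by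
  have hcont : Continuous fun w : ℝ × ℝ => H (axisRotation w.1 w.2 x) :=
    hH.comp (by unfold axisRotation; fun_prop)
  rw [integral_prod]
  · simp only [axisBackProjection, axisMean]
    rw [integral_const_mul]
    simp only [intervalIntegral.integral_of_le Real.two_pi_pos.le]
  · rw [Measure.prod_restrict]
    exact (hcont.continuousOn.integrableOn_compact
      (isCompact_Icc.prod isCompact_Icc)).mono_set
        (Set.prod_mono_right Set.Ioc_subset_Icc_self)

theorem integrable_axisBackProjection (hH : Continuous H) (hc : HasCompactSupport H) (a b : ℝ) :
    Integrable (axisBackProjection a b H) := by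
  rw [show axisBackProjection a b H = _ from funext (axisBackProjection_eq hH a b)]
  exact (integrable_axisRotation hH hc a b).integral_prod_left.const_mul _

/-- The motion preserves area and is a rotation about the origin followed by a translation; the
rotation passes to ξ and the translation yields the phase. -/
theorem integral_comp_axisRotation_mul_exp (hH : Continuous H) (p β : ℝ) (ξ : ℝ × ℝ) :
    ∫ x : ℝ × ℝ, H (axisRotation p β x) *
        Complex.exp (-Complex.I * ((x.1 * ξ.1 + x.2 * ξ.2 : ℝ) : ℂ)) =
      Complex.exp (Complex.I *
          ((p * (ξ.1 * Real.cos β + ξ.2 * Real.sin β - ξ.1) : ℝ) : ℂ)) *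
        planeFourier H (ξ.1 * Real.cos β + ξ.2 * Real.sin β,
          ξ.2 * Real.cos β - ξ.1 * Real.sin β) := by
  set g : ℝ × ℝ → ℂ := fun y => H y * Complex.exp (-Complex.I *
    (((axisRotation p (-β) y).1 * ξ.1 + (axisRotation p (-β) y).2 * ξ.2 : ℝ) : ℂ)) with hg
  have hgc : Continuous g := hH.mul (by unfold axisRotation; fun_prop)
  have hmp := measurePreserving_axisRotation p β
  have h1 : ∫ x, g (axisRotation p β x) = ∫ y, g y := by
    rw [← integral_map hmp.measurable.aemeasurable hgc.aestronglyMeasurable, hmp.map_eq]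
  have h2 : ∀ x, g (axisRotation p β x) = H (axisRotation p β x) *
      Complex.exp (-Complex.I * ((x.1 * ξ.1 + x.2 * ξ.2 : ℝ) : ℂ)) := fun x => by
    simp only [hg, axisRotation_neg]
  simp only [← h2]
  rw [h1, planeFourier, ← integral_const_mul]
  refine integral_congr_ae (Eventually.of_forall fun y => ?_)
  simp only [hg, axisRotation, Real.cos_neg, Real.sin_neg]
  rw [mul_left_comm, ← Complex.exp_add]
  congr 2
  push_cast
  ring

theorem planeFourier_axisBackProjection (hH : Continuous H) (hc : HasCompactSupport H) (a b : ℝ)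
    (ξ : ℝ × ℝ) :
    planeFourier (axisBackProjection a b H) ξ = (1 / (4 * (Real.pi : ℂ))) *
      ∫ w, Complex.exp (Complex.I *
          ((w.1 * (ξ.1 * Real.cos w.2 + ξ.2 * Real.sin w.2 - ξ.1) : ℝ) : ℂ)) *
        planeFourier H (ξ.1 * Real.cos w.2 + ξ.2 * Real.sin w.2,
          ξ.2 * Real.cos w.2 - ξ.1 * Real.sin w.2)
        ∂((volume.restrict (Set.Icc (-a) b)).prod (volume.restrict (Set.Ioc 0 (2 * Real.pi)))) := by
  set ν := (volume.restrict (Set.Icc (-a) b)).prod (volume.restrict (Set.Ioc 0 (2 * Real.pi)))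
    with hν
  have hint : Integrable (Function.uncurry fun (x w : ℝ × ℝ) => H (axisRotation w.1 w.2 x) *
      Complex.exp (-Complex.I * ((x.1 * ξ.1 + x.2 * ξ.2 : ℝ) : ℂ)))
      ((volume : Measure (ℝ × ℝ)).prod ν) := by
    refine (integrable_axisRotation hH hc a b).mul_bdd (c := 1) ?_ ?_
    · exact Continuous.aestronglyMeasurable (by fun_prop)
    · exact Eventually.of_forall fun y => (norm_exp_neg_I_mul_ofReal _).le
  rw [planeFourier]
  simp only [axisBackProjection_eq hH, mul_assoc, ← integral_mul_const]
  rw [integral_const_mul]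
  congr 1
  rw [integral_integral_swap hint]
  refine integral_congr_ae (Eventually.of_forall fun w => ?_)
  exact integral_comp_axisRotation_mul_exp hH w.1 w.2 ξ

/-- Rotations preserve |ξ|, so the decay of Ĥ survives averaging. The constant grows with b + a, so
this serves only for fixed truncation. -/
theorem planeFourier_axisBackProjection_bound {C : ℝ} (hH : Continuous H)
    (hc : HasCompactSupport H) (hE : CircleDecay (planeFourier H) C) (a b : ℝ) :
    ∃ K, 0 ≤ K ∧ ∀ ξ, ‖planeFourier (axisBackProjection a b H) ξ‖ ≤
      K / (1 + ξ.1 ^ 2 + ξ.2 ^ 2) ^ 3 := by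
  set ν := (volume.restrict (Set.Icc (-a) b)).prod (volume.restrict (Set.Ioc 0 (2 * Real.pi)))
  have hC := hE.nonneg
  refine ⟨‖1 / (4 * (Real.pi : ℂ))‖ * (C * ν.real Set.univ), by positivity, fun ξ => ?_⟩
  rw [planeFourier_axisBackProjection hH hc, norm_mul, mul_div_assoc]
  refine mul_le_mul_of_nonneg_left ?_ (norm_nonneg _)
  rw [mul_div_right_comm]
  refine norm_integral_le_of_norm_le_const (Eventually.of_forall fun w => ?_)
  rw [norm_mul, norm_exp_I_mul_ofReal, one_mul]
  refine (hE.bound _).trans_eq ?_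
  congr 2
  simp only
  linear_combination (ξ.1 ^ 2 + ξ.2 ^ 2) * Real.sin_sq_add_cos_sq w.2

theorem planeFourier_axisBackProjection_eq_circleTransform (hH : Continuous H)
    (hc : HasCompactSupport H) (heven : ∀ s y, planeFourier H (s, -y) = planeFourier H (s, y))
    (a b : ℝ) {ξ : ℝ × ℝ} (hξ : ξ.2 ≠ 0) :
    planeFourier (axisBackProjection a b H) ξ =
      (1 / (2 * (Real.pi : ℂ))) * circleTransform a b (planeFourier H) ξ := by
  set E := planeFourier H
  have hEc : Continuous E := continuous_planeFourier (hH.integrable_of_hasCompactSupport hc)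
  set R := √(ξ.1 ^ 2 + ξ.2 ^ 2) with hR
  have hR0 : 0 < R := Real.sqrt_pos.2 (by positivity)
  rw [planeFourier_axisBackProjection hH hc, integral_prod]
  swap
  · rw [Measure.prod_restrict]
    refine IntegrableOn.mono_set ?_ (Set.prod_mono_right Set.Ioc_subset_Icc_self)
    exact ContinuousOn.integrableOn_compact (isCompact_Icc.prod isCompact_Icc)
      (Continuous.continuousOn (Continuous.mul (by fun_prop) (hEc.comp (by fun_prop))))
  rw [circleTransform, truncatedFourierIntegral, show (1 / (4 * (Real.pi : ℂ))) =
    1 / (2 * (Real.pi : ℂ)) * (1 / 2) by ring, mul_assoc, ← integral_const_mul]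
  congr 1
  refine integral_congr_ae (Eventually.of_forall fun p => ?_)
  simp only
  rw [← intervalIntegral.integral_of_le Real.two_pi_pos.le]
  set Φ : ℝ → ℝ → ℂ := fun A B =>
    Complex.exp (Complex.I * ((p * (A - ξ.1) : ℝ) : ℂ)) * E (A, B) with hΦ
  -- The frequency is rotated clockwise, whereas `integral_circle_rotate` turns counterclockwise;
  -- reflecting the second coordinate reconciles the two.
  have h1 := integral_circle_rotate (fun A B => Φ A (-B)) ξ.1 (-ξ.2)
  have h2 : ∀ β : ℝ, Φ (ξ.1 * Real.cos β - -ξ.2 * Real.sin β)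
      (-(ξ.1 * Real.sin β + -ξ.2 * Real.cos β)) =
      Complex.exp (Complex.I * ((p * (ξ.1 * Real.cos β + ξ.2 * Real.sin β - ξ.1) : ℝ) : ℂ)) *
        E (ξ.1 * Real.cos β + ξ.2 * Real.sin β, ξ.2 * Real.cos β - ξ.1 * Real.sin β) := by
    intro β
    simp only [hΦ]
    rw [show ξ.1 * Real.cos β - -ξ.2 * Real.sin β = ξ.1 * Real.cos β + ξ.2 * Real.sin β by ring,
      show -(ξ.1 * Real.sin β + -ξ.2 * Real.cos β) = ξ.2 * Real.cos β - ξ.1 * Real.sin β by ring]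
  simp only [h2] at h1
  rw [← h1, neg_sq]
  simp only [hΦ, heven, ← hR]
  have h3 := integral_circle_eq_two_mul (ψ := fun β => Φ (R * Real.cos β) (R * Real.sin β))
    (by simp only [hΦ]; fun_prop)
    (fun β => by simp only [Real.cos_add_two_pi, Real.sin_add_two_pi])
    (fun β => by simp only [hΦ, Real.cos_neg, Real.sin_neg, mul_neg, heven])
  simp only [hΦ] at h3
  rw [h3, ← mul_assoc, show (1 / 2 : ℂ) * 2 = 1 by norm_num, one_mul]
  have h4 := integral_Ioo_div_sqrt hR0 Φ
  simp only [hΦ] at h4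
  rw [← h4, ← integral_indicator measurableSet_Ioo]
  refine integral_congr_ae (Eventually.of_forall fun s => ?_)
  by_cases hs : s ∈ Set.Ioo (-R) R
  · simp only [arcDensity, Set.indicator_of_mem hs]
    rw [mul_div_assoc]
  · simp only [arcDensity, Set.indicator_of_notMem hs, mul_zero]

theorem planeFourier_even (heven : ∀ z t, H (z, -t) = H (z, t)) (s y : ℝ) :
    planeFourier H (s, -y) = planeFourier H (s, y) := by
  have hmp : MeasurePreserving (Prod.map id Neg.neg : ℝ × ℝ → ℝ × ℝ) volume volume :=
    (MeasurePreserving.id volume).prod (Measure.measurePreserving_neg volume)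
  have hemb : MeasurableEmbedding (Prod.map id Neg.neg : ℝ × ℝ → ℝ × ℝ) :=
    ((MeasurableEquiv.refl ℝ).prodCongr (MeasurableEquiv.neg ℝ)).measurableEmbedding
  rw [planeFourier, ← hmp.integral_comp hemb, planeFourier]
  refine integral_congr_ae (Eventually.of_forall fun x => ?_)
  simp only [Prod.map, id, heven, neg_mul_neg]

end Circle

/-! ### Integrability from polynomial decay -/

theorem integrable_one_div_bracket_sq :
    Integrable fun ξ : ℝ × ℝ => 1 / (1 + ξ.1 ^ 2 + ξ.2 ^ 2) ^ 2 := by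
  have h1 : Integrable fun x : ℝ => 1 / (1 + x ^ 2) := by
    simpa only [one_div] using integrable_inv_one_add_sq
  refine (h1.mul_prod h1).mono' (Measurable.aestronglyMeasurable (by fun_prop))
    (Eventually.of_forall fun ξ => ?_)
  rw [Real.norm_of_nonneg (by positivity), one_div_mul_one_div]
  refine one_div_le_one_div_of_le (by positivity) ?_
  nlinarith [sq_nonneg ξ.1, sq_nonneg ξ.2, mul_nonneg (sq_nonneg ξ.1) (sq_nonneg ξ.2)]

theorem div_bracket_cube_le {K : ℝ} (hK : 0 ≤ K) (ξ : ℝ × ℝ) :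
    K / (1 + ξ.1 ^ 2 + ξ.2 ^ 2) ^ 3 ≤ K * (1 / (1 + ξ.1 ^ 2 + ξ.2 ^ 2) ^ 2) := by
  rw [div_eq_mul_one_div]
  refine mul_le_mul_of_nonneg_left (one_div_le_one_div_of_le (by positivity) ?_) hK
  exact pow_le_pow_right₀ (by nlinarith [sq_nonneg ξ.1, sq_nonneg ξ.2]) (by norm_num)

theorem integrable_of_bracket_bound {g : ℝ × ℝ → ℂ} (hg : Continuous g) {K : ℝ} (hK : 0 ≤ K)
    (h : ∀ ξ, ‖g ξ‖ ≤ K / (1 + ξ.1 ^ 2 + ξ.2 ^ 2) ^ 3) : Integrable g :=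
  (integrable_one_div_bracket_sq.const_mul K).mono' hg.aestronglyMeasurable
    (Eventually.of_forall fun ξ => (h ξ).trans (div_bracket_cube_le hK ξ))

theorem integrable_abs_mul_of_bracket_bound {g : ℝ × ℝ → ℂ} (hg : Continuous g) {K : ℝ}
    (h : ∀ ξ, ‖g ξ‖ ≤ K / (1 + ξ.1 ^ 2 + ξ.2 ^ 2) ^ 3) :
    Integrable fun ξ : ℝ × ℝ => ((|ξ.2| : ℝ) : ℂ) * g ξ := by
  refine (integrable_one_div_bracket_sq.const_mul K).mono'
    (Continuous.aestronglyMeasurable (by fun_prop)) (Eventually.of_forall fun ξ => ?_)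
  rw [norm_mul, Complex.norm_real, Real.norm_of_nonneg (abs_nonneg _)]
  have h1 : |ξ.2| ≤ 1 + ξ.1 ^ 2 + ξ.2 ^ 2 := by
    nlinarith [sq_nonneg (|ξ.2| - 1), sq_abs ξ.2, sq_nonneg ξ.1]
  calc |ξ.2| * ‖g ξ‖ ≤ (1 + ξ.1 ^ 2 + ξ.2 ^ 2) * (K / (1 + ξ.1 ^ 2 + ξ.2 ^ 2) ^ 3) :=
        mul_le_mul h1 (h ξ) (norm_nonneg _) (by positivity)
    _ = K * (1 / (1 + ξ.1 ^ 2 + ξ.2 ^ 2) ^ 2) := by field_simp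

/-! ### From tori to circular means in a half-plane section -/

section Slice

variable (u : ℝ) {f : EuclideanSpace ℝ (Fin 3) → ℂ} (μ : EuclideanSpace ℝ (Fin 2))

/-- The sum of the circular Radon transforms with radii `u - t` and `u + t`. -/
noncomputable def toroidalSlice (u : ℝ) (f : EuclideanSpace ℝ (Fin 3) → ℂ)
    (μ : EuclideanSpace ℝ (Fin 2)) (x : ℝ × ℝ) : ℂ :=
  circularRadon f μ x.1 (u - x.2) + circularRadon f μ x.1 (u + x.2)

/-- Replacing α by α + π reverses the sign of the radius. -/
theorem circularRadon_neg (f : EuclideanSpace ℝ (Fin 3) → ℂ) (z s : ℝ) :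
    circularRadon f μ z (-s) = circularRadon f μ z s := by
  set ψ : ℝ → ℂ := fun α => f !₂[μ 0 + s * Real.cos α, μ 1 + s * Real.sin α, z] with hψ
  have hper : Function.Periodic ψ (2 * Real.pi) := fun α => by
    simp only [hψ, Real.cos_add_two_pi, Real.sin_add_two_pi]
  have h1 := hper.intervalIntegral_add_eq 0 Real.pi
  have h2 := intervalIntegral.integral_comp_add_right (a := 0) (b := 2 * Real.pi) ψ Real.pi
  rw [zero_add] at h1 h2
  rw [add_comm (2 * Real.pi) Real.pi, ← h1] at h2
  simp only [circularRadon]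
  rw [← h2]
  simp only [hψ, Real.cos_add_pi, Real.sin_add_pi, mul_neg, neg_mul]

theorem toroidalSlice_neg (f : EuclideanSpace ℝ (Fin 3) → ℂ) (z t : ℝ) :
    toroidalSlice u f μ (z, -t) = toroidalSlice u f μ (z, t) := by
  simp only [toroidalSlice, sub_neg_eq_add, ← sub_eq_add_neg]
  exact add_comm _ _

theorem toroidalSlice_eq (f : EuclideanSpace ℝ (Fin 3) → ℂ) (z r : ℝ) :
    toroidalSlice u f μ (z, r) = circularRadon f μ z |u - r| + circularRadon f μ z (u + r) := by
  simp only [toroidalSlice]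
  rcases abs_choice (u - r) with h | h <;> rw [h]
  rw [circularRadon_neg]

theorem contDiff_circularRadon (hf : ContDiff ℝ ∞ f) :
    ContDiff ℝ ∞ fun x : ℝ × ℝ => circularRadon f μ x.1 x.2 := by
  refine contDiff_intervalIntegral_param (E := ℝ × ℝ) 0 (2 * Real.pi)
    (f := fun y : (ℝ × ℝ) × ℝ => f !₂[μ 0 + y.1.2 * Real.cos y.2, μ 1 + y.1.2 * Real.sin y.2, y.1.1])
    (hf.comp ?_)
  rw [contDiff_euclidean]
  intro i
  fin_cases i <;> simp <;> fun_prop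

theorem contDiff_toroidalSlice (hf : ContDiff ℝ ∞ f) : ContDiff ℝ ∞ (toroidalSlice u f μ) := by
  have h := contDiff_circularRadon μ hf
  exact (h.comp (by fun_prop : ContDiff ℝ ∞ fun x : ℝ × ℝ => (x.1, u - x.2))).add
    (h.comp (by fun_prop : ContDiff ℝ ∞ fun x : ℝ × ℝ => (x.1, u + x.2)))

theorem exists_circularRadon_eq_zero (hfc : HasCompactSupport f) :
    ∃ L, 0 ≤ L ∧ ∀ z s : ℝ, L < |z| ∨ L < |s| → circularRadon f μ z s = 0 := by
  obtain ⟨L, hL⟩ := hfc.isCompact.isBounded.exists_norm_le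
  have hz : ∀ y, f y ≠ 0 → ∀ i, |y i| ≤ L := fun y hy i =>
    (PiLp.norm_apply_le y i).trans (hL y (subset_tsupport f hy))
  set L' := max L 0 with hL'
  have hL0 : 0 ≤ L' := le_max_right _ _
  have hLL : L ≤ L' := le_max_left _ _
  refine ⟨2 * L' + |μ 0| + |μ 1|, by positivity, fun z s h => ?_⟩
  rw [circularRadon]
  rw [show (fun α : ℝ => f !₂[μ 0 + s * Real.cos α, μ 1 + s * Real.sin α, z]) = fun _ => 0 from ?_]
  · simp
  funext α
  by_contra hne
  have h0 := hz _ hne 0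
  have h1 := hz _ hne 1
  have h2 := hz _ hne 2
  simp only [Fin.isValue, Matrix.cons_val_zero, Matrix.cons_val_one,
    Matrix.cons_val] at h0 h1 h2
  have p0 := abs_nonneg (μ 0)
  have p1 := abs_nonneg (μ 1)
  rcases h with h | h
  · linarith
  · have a0 : |s * Real.cos α| ≤ L' + |μ 0| := by
      have := abs_sub (μ 0 + s * Real.cos α) (μ 0)
      rw [add_sub_cancel_left] at this
      linarith
    have a1 : |s * Real.sin α| ≤ L' + |μ 1| := by
      have := abs_sub (μ 1 + s * Real.sin α) (μ 1)
      rw [add_sub_cancel_left] at this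
      linarith
    have b0 := sq_le_sq' (by linarith [abs_nonneg (s * Real.cos α)]) a0
    have b1 := sq_le_sq' (by linarith [abs_nonneg (s * Real.sin α)]) a1
    rw [sq_abs] at b0 b1
    -- Both components are bounded by L' plus |μ 0| or |μ 1|, so s² is at most the square of the sum
    -- of these bounds, which is the chosen radius.
    have hs2 : s ^ 2 = (s * Real.cos α) ^ 2 + (s * Real.sin α) ^ 2 := by
      linear_combination -s ^ 2 * Real.sin_sq_add_cos_sq α
    have := sq_abs s
    nlinarith

theorem hasCompactSupport_toroidalSlice (hfc : HasCompactSupport f) :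
    HasCompactSupport (toroidalSlice u f μ) := by
  obtain ⟨L, hL0, hL⟩ := exists_circularRadon_eq_zero μ hfc
  refine HasCompactSupport.intro ((isCompact_Icc (a := -L) (b := L)).prod
    (isCompact_Icc (a := -(L + |u|)) (b := L + |u|))) fun x hx => ?_
  rw [Set.mem_prod, Set.mem_Icc, Set.mem_Icc, ← abs_le, ← abs_le, not_and_or, not_le, not_le] at hx
  rw [toroidalSlice, hL, hL, add_zero]
  · rcases hx with h | h
    · exact Or.inl h
    · right
      have := abs_sub (u + x.2) u
      rw [add_sub_cancel_left] at this
      linarith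
  · rcases hx with h | h
    · exact Or.inl h
    · right
      have := abs_sub u (u - x.2)
      rw [sub_sub_cancel] at this
      linarith

/-- After the α-integral is done, the integrand is Mf at radius u - r cos β. The substitution β ↦ π
- β exchanges it with u + r cos β, and averaging the two turns 1/(2π) into 1/(4π). -/
theorem toroidalRadon_eq_circle (hf : Continuous f) (p r : ℝ) :
    toroidalRadon u f μ p r = (1 / (4 * (Real.pi : ℂ))) *
      ∫ β in (0 : ℝ)..(2 * Real.pi), toroidalSlice u f μ (p + r * Real.sin β, r * Real.cos β) := by
  have hc : Continuous fun y : ℝ × ℝ => circularRadon f μ y.1 y.2 := by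
    refine intervalIntegral.continuous_parametric_intervalIntegral_of_continuous' ?_ _ _
    refine hf.comp ((PiLp.continuous_toLp 2 _).comp (continuous_pi fun i => ?_))
    fin_cases i <;> simp <;> fun_prop
  set ψ : ℝ → ℂ := fun β => circularRadon f μ (p + r * Real.sin β) (u - r * Real.cos β) with hψ
  have hψc : Continuous ψ := hc.comp (by fun_prop : Continuous fun β : ℝ =>
    (p + r * Real.sin β, u - r * Real.cos β))
  have hper : Function.Periodic ψ (2 * Real.pi) := fun β => by
    simp only [hψ, Real.cos_add_two_pi, Real.sin_add_two_pi]
  have hswap : toroidalRadon u f μ p r = (1 / (2 * (Real.pi : ℂ))) *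
      ∫ β in (0 : ℝ)..(2 * Real.pi), ψ β := by
    rw [toroidalRadon, intervalIntegral_intervalIntegral_swap]
    · rfl
    · refine IntegrableOn.mono_set (ContinuousOn.integrableOn_compact
        (isCompact_uIcc.prod isCompact_uIcc) (Continuous.continuousOn ?_))
        (Set.prod_mono Set.uIoc_subset_uIcc Set.uIoc_subset_uIcc)
      refine hf.comp ((PiLp.continuous_toLp 2 _).comp (continuous_pi fun i => ?_))
      fin_cases i <;> simp <;> fun_prop
  have hrefl : ∫ β in (0 : ℝ)..(2 * Real.pi), ψ (Real.pi - β) =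
      ∫ β in (0 : ℝ)..(2 * Real.pi), ψ β := by
    rw [intervalIntegral.integral_comp_sub_left]
    have h := hper.intervalIntegral_add_eq (Real.pi - 2 * Real.pi) 0
    rw [sub_add_cancel, zero_add] at h
    rw [sub_zero, h]
  have hsum : ∀ β : ℝ, toroidalSlice u f μ (p + r * Real.sin β, r * Real.cos β) =
      ψ β + ψ (Real.pi - β) := by
    intro β
    simp only [toroidalSlice, hψ, Real.sin_pi_sub, Real.cos_pi_sub, mul_neg, sub_neg_eq_add]
  simp only [hsum]
  rw [intervalIntegral.integral_add (hψc.intervalIntegrable _ _)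
    (Continuous.intervalIntegrable (by fun_prop : Continuous fun β : ℝ => ψ (Real.pi - β)) _ _),
    hrefl, hswap]
  ring

/-- The radius √((z-p)²+ρ²) is that of the circle about (p,0) through (z,ρ), so the starting angle
can be moved to that point. -/
theorem toroidalRadon_sqrt_eq_axisMean (hf : Continuous f) (p z ρ : ℝ) :
    toroidalRadon u f μ p (√((z - p) ^ 2 + ρ ^ 2)) = axisMean (toroidalSlice u f μ) p (z, ρ) := by
  rw [toroidalRadon_eq_circle u μ hf, axisMean, add_comm ((z - p) ^ 2)]
  rw [integral_circle_rotate (fun A B => toroidalSlice u f μ (p + B, A)) ρ (z - p)]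
  congr 1
  refine intervalIntegral.integral_congr fun β _ => ?_
  simp only [axisRotation]
  congr 2
  ring

theorem backProjection_truncateHeight (hf : Continuous f) (a b z ρ : ℝ) :
    backProjection (truncateHeight a b (toroidalRadon u f)) μ z ρ =
      axisBackProjection a b (toroidalSlice u f μ) (z, ρ) := by
  rw [backProjection, axisBackProjection, ← integral_indicator measurableSet_Icc]
  refine integral_congr_ae (Eventually.of_forall fun p => ?_)
  simp only [truncateHeight, Set.indicator]
  split_ifs
  · exact toroidalRadon_sqrt_eq_axisMean u μ hf p z ρ
  · rfl

theorem fourierLastTwo_eq_planeFourier (h : EuclideanSpace ℝ (Fin 2) → ℝ → ℝ → ℂ) :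
    fourierLastTwo h μ = planeFourier fun x => h μ x.1 x.2 := rfl

theorem fourierLastTwo_backProjection_truncateHeight (hf : Continuous f) (a b : ℝ) :
    fourierLastTwo (backProjection (truncateHeight a b (toroidalRadon u f))) μ =
      planeFourier (axisBackProjection a b (toroidalSlice u f μ)) := by
  rw [fourierLastTwo_eq_planeFourier]
  congr 1
  funext x
  exact backProjection_truncateHeight u μ hf a b x.1 x.2

theorem filteredBackProjectionConverges_truncateHeight (hf : ContDiff ℝ ∞ f)
    (hfc : HasCompactSupport f) (a b : ℝ) :
    FilteredBackProjectionConverges (truncateHeight a b (toroidalRadon u f)) μ := by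
  have hH := contDiff_toroidalSlice u μ hf
  have hHc := hasCompactSupport_toroidalSlice u μ hfc
  obtain ⟨C, hC⟩ := exists_circleDecay_planeFourier hH hHc
  obtain ⟨K, -, hb⟩ := planeFourier_axisBackProjection_bound hH.continuous hHc hC a b
  have hi := integrable_axisBackProjection hH.continuous hHc a b
  refine ⟨fun z ρ => ?_, ?_, ?_⟩
  · have h1 : IntegrableOn (fun p => axisMean (toroidalSlice u f μ) p (z, ρ)) (Set.Icc (-a) b) :=
      ContinuousOn.integrableOn_compact isCompact_Icc
        ((continuous_axisMean hH.continuous).comp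
          (by fun_prop : Continuous fun p : ℝ => (p, z, ρ))).continuousOn
    refine ((integrable_indicator_iff measurableSet_Icc).2 h1).congr
      (Eventually.of_forall fun p => ?_)
    simp only [truncateHeight, Set.indicator]
    split_ifs
    · exact (toroidalRadon_sqrt_eq_axisMean u μ hf.continuous p z ρ).symm
    · rfl
  · simp only [backProjection_truncateHeight u μ hf.continuous]
    exact hi
  · rw [fourierLastTwo_backProjection_truncateHeight u μ hf.continuous]
    exact integrable_abs_mul_of_bracket_bound (continuous_planeFourier hi) hb

theorem ae_snd_ne_zero : ∀ᵐ ξ : ℝ × ℝ, ξ.2 ≠ 0 := by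
  have h : ∀ᵐ y : ℝ, y ≠ 0 := (measure_singleton (0 : ℝ)) |> compl_mem_ae_iff.2
  exact Measure.quasiMeasurePreserving_snd.ae h

/-- Dominated convergence in ξ off the null line ξ₂ = 0. The limiting integrand is Ĥ times the
inverse kernel, because evenness removes the absolute value in Ĥ(ξ₁,|ξ₂|). -/
theorem tendsto_rieszTwoInv_truncateHeight (hf : ContDiff ℝ ∞ f) (hfc : HasCompactSupport f)
    (z ρ : ℝ) :
    Tendsto (fun ab : ℝ × ℝ =>
      rieszTwoInv (backProjection (truncateHeight ab.1 ab.2 (toroidalRadon u f))) μ z ρ)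
      (atTop ×ˢ atTop) (𝓝 (toroidalSlice u f μ (z, ρ))) := by
  set H := toroidalSlice u f μ with hHdef
  have hH : ContDiff ℝ ∞ H := contDiff_toroidalSlice u μ hf
  have hHc : HasCompactSupport H := hasCompactSupport_toroidalSlice u μ hfc
  have heven : ∀ s y, planeFourier H (s, -y) = planeFourier H (s, y) :=
    planeFourier_even (toroidalSlice_neg u μ f)
  obtain ⟨C, hC⟩ := exists_circleDecay_planeFourier hH hHc
  obtain ⟨⟨K, hK⟩, hlim⟩ := hC.abs_mul_circleTransform
  have hHi := hH.continuous.integrable_of_hasCompactSupport (μ := volume) hHc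
  have hinv := planeFourier_inversion hH.continuous hHi
    (integrable_of_bracket_bound hC.continuous hC.nonneg hC.bound) (z, ρ)
  rw [← hinv]
  simp only [rieszTwoInv, fourierLastTwo_backProjection_truncateHeight u μ hf.continuous]
  refine Tendsto.const_mul _ ?_
  refine tendsto_integral_filter_of_dominated_convergence
    (fun ξ => ‖1 / (2 * (Real.pi : ℂ))‖ * (K * frequencyMajorant ξ)) ?_ ?_
    ((integrable_frequencyMajorant.const_mul K).const_mul _) ?_
  · refine Eventually.of_forall fun ab => Continuous.aestronglyMeasurable ?_
    have := continuous_planeFourier (integrable_axisBackProjection hH.continuous hHc ab.1 ab.2)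
    fun_prop
  · refine Eventually.of_forall fun ab => ?_
    filter_upwards [ae_snd_ne_zero] with ξ hξ
    rw [norm_mul, norm_exp_I_mul_ofReal, mul_one,
      planeFourier_axisBackProjection_eq_circleTransform hH.continuous hHc heven _ _ hξ,
      mul_left_comm, norm_mul]
    exact mul_le_mul_of_nonneg_left (hK ξ hξ ab.1 ab.2) (norm_nonneg _)
  · filter_upwards [ae_snd_ne_zero] with ξ hξ
    refine Tendsto.mul_const _ ?_
    have hval : planeFourier H ξ = (1 / (2 * (Real.pi : ℂ))) *
        (2 * Real.pi * planeFourier H (ξ.1, |ξ.2|)) := by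
      have hE : planeFourier H (ξ.1, |ξ.2|) = planeFourier H ξ := by
        rcases abs_choice ξ.2 with h | h <;> rw [h]
        rw [heven]
      have : (Real.pi : ℂ) ≠ 0 := by exact_mod_cast Real.pi_ne_zero
      rw [hE]
      field_simp
    rw [hval]
    refine ((hlim ξ hξ).const_mul (1 / (2 * (Real.pi : ℂ)))).congr fun ab => ?_
    rw [planeFourier_axisBackProjection_eq_circleTransform hH.continuous hHc heven _ _ hξ]
    ring

end Slice

/-! ### Absolute convergence forces vanishing vertical integrals -/

section VerticalIntegral

variable {H : ℝ × ℝ → ℂ}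

theorem exists_support_bound (hc : HasCompactSupport H) :
    ∃ L, 0 < L ∧ ∀ x, H x ≠ 0 → |x.1| < L ∧ |x.2| < L := by
  obtain ⟨L, hL⟩ := hc.isCompact.isBounded.exists_norm_le
  refine ⟨max L 0 + 1, by positivity, fun x hx => ?_⟩
  have h := hL x (subset_tsupport H hx)
  have h1 := (norm_fst_le x).trans h
  have h2 := (norm_snd_le x).trans h
  rw [Real.norm_eq_abs] at h1 h2
  constructor <;> linarith [le_max_left L 0]

/-- The variable y = qβ is arc length from (z,0) on the circle of radius q; it fixes the
normalisation needed as q → ∞. -/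
theorem mul_axisMean_eq (H : ℝ × ℝ → ℂ) {q : ℝ} (hq : 0 < q) (z : ℝ) :
    (q : ℂ) * axisMean H (z + q) (z, 0) = (1 / (4 * (Real.pi : ℂ))) *
      ∫ y, (Set.Ioc (-(Real.pi * q)) (Real.pi * q)).indicator
        (fun y => H (z + q * (1 - Real.cos (y / q)), q * Real.sin (y / q))) y := by
  set ψ : ℝ → ℂ := fun β => H (z + q * (1 - Real.cos β), q * Real.sin β) with hψ
  have hper : Function.Periodic ψ (2 * Real.pi) := fun β => by
    simp only [hψ, Real.cos_add_two_pi, Real.sin_add_two_pi]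
  have h1 : axisMean H (z + q) (z, 0) = (1 / (4 * (Real.pi : ℂ))) *
      ∫ β in (0 : ℝ)..(2 * Real.pi), ψ β := by
    rw [axisMean]
    congr 1
    refine intervalIntegral.integral_congr fun β _ => ?_
    simp only [axisRotation, hψ]
    congr 2 <;> ring
  have h2 := hper.intervalIntegral_add_eq 0 (-Real.pi)
  rw [zero_add, show -Real.pi + 2 * Real.pi = Real.pi by ring] at h2
  have h3 := intervalIntegral.integral_comp_div (a := -(Real.pi * q)) (b := Real.pi * q) ψ hq.ne'
  rw [neg_div, mul_div_cancel_right₀ _ hq.ne', ← h2, Complex.real_smul] at h3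
  rw [h1, mul_left_comm, ← h3, integral_indicator measurableSet_Ioc,
    intervalIntegral.integral_of_le (by nlinarith [Real.pi_pos])]

/-- In arc length the circle of radius q tends pointwise to the vertical line through (z,0). Compact
support of H provides a dominating function. -/
theorem tendsto_mul_axisMean (hH : Continuous H) (hc : HasCompactSupport H) (z : ℝ) :
    Tendsto (fun q : ℝ => (q : ℂ) * axisMean H (z + q) (z, 0)) atTop
      (𝓝 ((1 / (4 * (Real.pi : ℂ))) * ∫ y, H (z, y))) := by
  obtain ⟨L, hL0, hL⟩ := exists_support_bound hc
  obtain ⟨M, hM⟩ := hH.bounded_above_of_compact_support hc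
  have hpi := Real.pi_pos
  have hmain : Tendsto (fun q : ℝ => ∫ y, (Set.Ioc (-(Real.pi * q)) (Real.pi * q)).indicator
      (fun y => H (z + q * (1 - Real.cos (y / q)), q * Real.sin (y / q))) y) atTop
      (𝓝 (∫ y, H (z, y))) := by
    refine tendsto_integral_filter_of_dominated_convergence
      ((Set.Icc (-(Real.pi * L)) (Real.pi * L)).indicator fun _ => M) ?_ ?_ ?_ ?_
    · refine Eventually.of_forall fun q => ?_
      exact ((hH.comp (by fun_prop : Continuous fun y : ℝ =>
        (z + q * (1 - Real.cos (y / q)), q * Real.sin (y / q)))).measurable.indicator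
          measurableSet_Ioc).aestronglyMeasurable
    · filter_upwards [eventually_gt_atTop (L + |z|)] with q hq
      refine Eventually.of_forall fun y => ?_
      have hq0 : 0 < q := by linarith [abs_nonneg z]
      have hM0 : 0 ≤ M := (norm_nonneg _).trans (hM 0)
      by_cases hmem : y ∈ Set.Ioc (-(Real.pi * q)) (Real.pi * q)
      swap
      · rw [Set.indicator_of_notMem hmem, norm_zero]
        exact Set.indicator_nonneg (fun _ _ => hM0) _
      rw [Set.indicator_of_mem hmem]
      by_cases hne : H (z + q * (1 - Real.cos (y / q)), q * Real.sin (y / q)) = 0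
      · rw [hne, norm_zero]
        exact Set.indicator_nonneg (fun _ _ => hM0) _
      obtain ⟨h1, h2⟩ := hL _ hne
      simp only at h1 h2
      set β := y / q with hβ
      have hy : y = β * q := by rw [hβ]; field_simp
      have hβ1 : |β| ≤ Real.pi := by
        rw [abs_le, hβ, le_div_iff₀ hq0, div_le_iff₀ hq0]
        constructor <;> linarith [hmem.1, hmem.2]
      -- The half of the circle with cos β ≤ 0 has abscissa at least z + q > L and misses the
      -- support.
      have hcos : 0 < Real.cos β := by
        have := le_abs_self (z + q * (1 - Real.cos β))
        have := neg_abs_le z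
        by_contra hcon
        push Not at hcon
        nlinarith
      have hβ2 : |β| ≤ Real.pi / 2 := by
        by_contra hcon
        push Not at hcon
        have := Real.cos_nonpos_of_pi_div_two_le_of_le hcon.le (by linarith)
        rw [Real.cos_abs] at this
        linarith
      -- Jordan's inequality sin|β| ≥ 2|β|/π turns the bound on the ordinate into one on arc length.
      have hsin := Real.mul_le_sin (abs_nonneg β) hβ2
      have hsin2 : Real.sin |β| ≤ |Real.sin β| := by
        rcases abs_choice β with h | h <;> rw [h]
        · exact le_abs_self _
        · rw [Real.sin_neg]
          exact neg_le_abs _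
      have hyL : |y| ≤ Real.pi * L := by
        rw [hy, abs_mul, abs_of_pos hq0]
        rw [abs_mul, abs_of_pos hq0] at h2
        have h3 : 2 / Real.pi * |β| ≤ |Real.sin β| := hsin.trans hsin2
        rw [div_mul_eq_mul_div, div_le_iff₀ hpi] at h3
        nlinarith [abs_nonneg β, mul_le_mul_of_nonneg_left h3 hq0.le,
          mul_lt_mul_of_pos_right h2 hpi, mul_nonneg (abs_nonneg β) hq0.le]
      rw [Set.indicator_of_mem (show y ∈ Set.Icc (-(Real.pi * L)) (Real.pi * L) from
        abs_le.1 hyL)]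
      exact hM _
    · exact (integrable_indicator_iff measurableSet_Icc).2
        (integrableOn_const (by simp) (by simp))
    · refine Eventually.of_forall fun y => ?_
      have hdiv : Tendsto (fun q : ℝ => y / q) atTop (𝓝 0) := tendsto_const_nhds.div_atTop tendsto_id
      have h1 : Tendsto (fun q : ℝ => q * (1 - Real.cos (y / q))) atTop (𝓝 0) := by
        have hb : Tendsto (fun q : ℝ => y ^ 2 / 2 / q) atTop (𝓝 0) :=
          tendsto_const_nhds.div_atTop tendsto_id
        refine squeeze_zero' ?_ ?_ hb
        · filter_upwards [eventually_gt_atTop 0] with q hq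
          exact mul_nonneg hq.le (by linarith [Real.cos_le_one (y / q)])
        · filter_upwards [eventually_gt_atTop 0] with q hq
          have := Real.one_sub_sq_div_two_le_cos (x := y / q)
          calc q * (1 - Real.cos (y / q)) ≤ q * ((y / q) ^ 2 / 2) :=
                mul_le_mul_of_nonneg_left (by linarith) hq.le
            _ = y ^ 2 / 2 / q := by field_simp
      have h2 : Tendsto (fun q : ℝ => q * Real.sin (y / q)) atTop (𝓝 y) := by
        have hs : Tendsto (fun q : ℝ => y * Real.sinc (y / q)) atTop (𝓝 y) := by
          have := ((Real.continuous_sinc.tendsto 0).comp hdiv).const_mul y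
          simpa using this
        refine hs.congr' ?_
        filter_upwards [eventually_gt_atTop 0] with q hq
        rcases eq_or_ne y 0 with rfl | hy
        · simp
        · rw [Real.sinc_of_ne_zero (div_ne_zero hy hq.ne')]
          field_simp
      have h3 : Tendsto (fun q : ℝ => (z + q * (1 - Real.cos (y / q)), q * Real.sin (y / q))) atTop
          (𝓝 (z, y)) := by
        have := (h1.const_add z).prodMk_nhds h2
        rwa [add_zero] at this
      refine ((hH.tendsto (z, y)).comp h3).congr' ?_
      filter_upwards [eventually_gt_atTop |y|] with q hq
      have hyq := abs_lt.1 hq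
      have hq0 : 0 < q := (abs_nonneg y).trans_lt hq
      have hpi1 : 1 ≤ Real.pi := by linarith [Real.pi_gt_three]
      rw [Set.indicator_of_mem]
      · rfl
      · constructor <;> nlinarith [hyq.1, hyq.2]
  refine (hmain.const_mul (1 / (4 * (Real.pi : ℂ)))).congr' ?_
  filter_upwards [eventually_gt_atTop 0] with q hq
  exact (mul_axisMean_eq H hq z).symm

/-- If the back-projection converges absolutely on the axis, then `H` has vanishing integral along
every line orthogonal to the axis. -/
theorem integral_eq_zero_of_integrable_axisMean (hH : Continuous H) (hc : HasCompactSupport H)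
    {z : ℝ} (hint : Integrable fun p => axisMean H p (z, 0)) : ∫ y, H (z, y) = 0 := by
  by_contra hne
  set c := (1 / (4 * (Real.pi : ℂ))) * ∫ y, H (z, y) with hcdef
  have hc0 : 0 < ‖c‖ := norm_pos_iff.2 (mul_ne_zero (by simp [Real.pi_ne_zero]) hne)
  have h1 := (tendsto_mul_axisMean hH hc z).norm
  have h2 : ∀ᶠ q : ℝ in atTop, ‖c‖ / 2 < ‖(q : ℂ) * axisMean H (z + q) (z, 0)‖ :=
    h1.eventually (lt_mem_nhds (by linarith))
  obtain ⟨N, hN⟩ := (h2.and (eventually_gt_atTop 0)).exists_forall_of_atTop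
  have hint' : Integrable fun q => axisMean H (z + q) (z, 0) := hint.comp_add_left z
  -- If the limit c were nonzero, the mean would eventually exceed ‖c‖/(2q), and 1/q would be
  -- integrable at infinity.
  refine not_integrableOn_Ioi_inv (a := N) ?_
  refine ((hint'.norm.const_mul (2 / ‖c‖)).integrableOn).mono'
    measurable_inv.aestronglyMeasurable ?_
  refine (ae_restrict_iff' measurableSet_Ioi).2 (Eventually.of_forall fun q hq => ?_)
  obtain ⟨h3, h4⟩ := hN q (le_of_lt hq)
  rw [norm_mul (q : ℂ), Complex.norm_real, Real.norm_of_nonneg h4.le] at h3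
  rw [Real.norm_of_nonneg (inv_nonneg.2 h4.le), inv_eq_one_div, div_mul_eq_mul_div,
    div_le_div_iff₀ h4 hc0]
  linarith

end VerticalIntegral

/-! ### Compactly supported primitives in the second variable -/

/-- Integrate from below the support; the primitive vanishes above it exactly because the full
integrals are zero. -/
theorem exists_primitive_snd {H : ℝ × ℝ → ℂ} (hH : ContDiff ℝ ∞ H) (hc : HasCompactSupport H)
    (h0 : ∀ z, ∫ t, H (z, t) = 0) :
    ∃ G : ℝ × ℝ → ℂ, ContDiff ℝ ∞ G ∧ HasCompactSupport G ∧
      ∀ z t, HasDerivAt (fun t => G (z, t)) (H (z, t)) t := by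
  obtain ⟨L, hL0, hL⟩ := exists_support_bound hc
  have hz : ∀ z t, L ≤ |z| ∨ L ≤ |t| → H (z, t) = 0 := by
    intro z t h
    by_contra hne
    obtain ⟨h1, h2⟩ := hL _ hne
    rcases h with h | h
    · exact absurd h1 (not_lt.2 h)
    · exact absurd h2 (not_lt.2 h)
  set G : ℝ × ℝ → ℂ := fun x => ∫ s in (-L)..x.2, H (x.1, s) with hG
  -- Rescaling to the fixed interval [0,1] makes smoothness in both variables a case of
  -- `contDiff_intervalIntegral_param`.
  have hGeq : G = fun x : ℝ × ℝ => (x.2 + L) • ∫ σ in (0 : ℝ)..1, H (x.1, (x.2 + L) * σ - L) := by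
    funext x
    rw [intervalIntegral.smul_integral_comp_mul_sub (f := fun s => H (x.1, s))]
    simp only [hG]
    congr 1 <;> ring
  have hcs : ∀ z, Continuous fun s => H (z, s) := fun z =>
    hH.continuous.comp (by fun_prop)
  have hleft : ∀ z t, t ≤ -L → G (z, t) = 0 := by
    intro z t ht
    simp only [hG]
    rw [intervalIntegral.integral_symm, intervalIntegral.integral_of_le ht]
    rw [setIntegral_eq_zero_of_forall_eq_zero, neg_zero]
    intro s hs
    refine hz z s (Or.inr ?_)
    rw [le_abs]
    right
    linarith [hs.2]
  have hright : ∀ z t, L ≤ t → G (z, t) = 0 := by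
    intro z t ht
    simp only [hG]
    rw [intervalIntegral.integral_of_le (by linarith), setIntegral_eq_integral_of_forall_compl_eq_zero,
      h0 z]
    intro s hs
    refine hz z s (Or.inr ?_)
    rw [le_abs]
    by_contra hcon
    push Not at hcon
    exact hs ⟨by linarith [hcon.2], by linarith [hcon.1]⟩
  refine ⟨G, ?_, ?_, ?_⟩
  · rw [hGeq]
    refine ContDiff.smul (by fun_prop : ContDiff ℝ ∞ fun x : ℝ × ℝ => x.2 + L) ?_
    exact contDiff_intervalIntegral_param (E := ℝ × ℝ) 0 1
      (f := fun y : (ℝ × ℝ) × ℝ => H (y.1.1, (y.1.2 + L) * y.2 - L)) (hH.comp (by fun_prop))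
  · refine HasCompactSupport.intro ((isCompact_Icc (a := -L) (b := L)).prod
      (isCompact_Icc (a := -L) (b := L))) fun x hx => ?_
    rw [Set.mem_prod, not_and_or, Set.mem_Icc, ← abs_le, not_le, Set.mem_Icc, not_and_or, not_le,
      not_le] at hx
    rcases hx with h | h | h
    · simp only [hG]
      simp [hz x.1 _ (Or.inl h.le)]
    · exact hleft x.1 x.2 h.le
    · exact hright x.1 x.2 h.le
  · intro z t
    exact intervalIntegral.integral_hasDerivAt_right ((hcs z).intervalIntegrable _ _)
      ((hcs z).stronglyMeasurableAtFilter _ _) (hcs z).continuousAt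

/-- G(z,t) + G(z,-t) has zero derivative in t and vanishes for large t. -/
theorem eq_neg_of_hasDerivAt_even {H G : ℝ × ℝ → ℂ} (hc : HasCompactSupport G)
    (hd : ∀ z t, HasDerivAt (fun t => G (z, t)) (H (z, t)) t) (heven : ∀ z t, H (z, -t) = H (z, t))
    (z t : ℝ) : G (z, -t) = -G (z, t) := by
  obtain ⟨L, hL0, hL⟩ := exists_support_bound hc
  have hz : ∀ t, L ≤ |t| → G (z, t) = 0 := fun t ht => by
    by_contra hne
    exact absurd (hL _ hne).2 (not_lt.2 ht)
  have h1 : ∀ t, HasDerivAt (fun t => G (z, t) + G (z, -t)) 0 t := by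
    intro t
    have h2 := (hd z t).add ((hd z (-t)).scomp t (hasDerivAt_neg t))
    refine h2.congr_deriv ?_
    simp [heven]
  have h2 := is_const_of_deriv_eq_zero (fun t => (h1 t).differentiableAt) (fun t => (h1 t).deriv) t L
  rw [hz L (le_abs_self L), hz (-L) (by rw [abs_neg]; exact le_abs_self L), add_zero] at h2
  exact eq_neg_of_add_eq_zero_right h2

/-- A test function that is even in `t` and has vanishing integrals over `t` is the second
`t`-derivative of a test function. -/
theorem exists_second_primitive_snd {H : ℝ × ℝ → ℂ} (hH : ContDiff ℝ ∞ H)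
    (hc : HasCompactSupport H) (heven : ∀ z t, H (z, -t) = H (z, t))
    (h0 : ∀ z, ∫ t, H (z, t) = 0) :
    ∃ G G' : ℝ × ℝ → ℂ, ContDiff ℝ ∞ G ∧ HasCompactSupport G ∧ ContDiff ℝ ∞ G' ∧
      HasCompactSupport G' ∧ (∀ z t, HasDerivAt (fun t => G (z, t)) (G' (z, t)) t) ∧
      ∀ z t, HasDerivAt (fun t => G' (z, t)) (H (z, t)) t := by
  obtain ⟨G', hG', hGc', hGd'⟩ := exists_primitive_snd hH hc h0
  have hodd := eq_neg_of_hasDerivAt_even hGc' hGd' heven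
  -- The first primitive is odd, so its integrals vanish and it can be integrated once more within
  -- test functions.
  obtain ⟨G, hG, hGc, hGd⟩ := exists_primitive_snd hG' hGc' fun z => by
    have h1 := integral_neg_eq_self (fun t => G' (z, t)) volume
    simp only [hodd, integral_neg] at h1
    exact self_eq_neg.1 h1.symm
  exact ⟨G, G', hG, hGc, hG', hGc', hGd, hGd'⟩

theorem planeFourier_of_hasDerivAt_snd {G G' : ℝ × ℝ → ℂ} (hG : ContDiff ℝ ∞ G)
    (hc : HasCompactSupport G) (hd : ∀ z t, HasDerivAt (fun t => G (z, t)) (G' (z, t)) t)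
    (ξ : ℝ × ℝ) : planeFourier G' ξ = Complex.I * (ξ.2 : ℂ) * planeFourier G ξ := by
  have h1 : ∀ x : ℝ × ℝ, fderiv ℝ G x (0, 1) = G' x := by
    rintro ⟨z, t⟩
    have h2 : HasFDerivAt G (fderiv ℝ G (z, t)) (z, t) :=
      (hG.differentiable (by simp) (z, t)).hasFDerivAt
    have h3 : HasDerivAt (fun t : ℝ => (z, t)) ((0, 1) : ℝ × ℝ) t :=
      (hasDerivAt_const t z).prodMk (hasDerivAt_id t)
    exact (h2.comp_hasDerivAt t h3).unique (hd z t)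
  have h2 := planeFourier_fderiv (hG.of_le (by simp)) hc (0, 1) ξ
  simpa [h1] using h2

/-! ### The operator |∂_t| as a hypersingular integral -/

theorem two_sub_two_mul_cos_nonneg (y : ℝ) : 0 ≤ 2 - 2 * Real.cos y := by
  linarith [Real.cos_le_one y]

theorem integrable_two_sub_two_mul_cos_div_sq :
    Integrable fun y : ℝ => (2 - 2 * Real.cos y) / y ^ 2 := by
  have h1 : Integrable fun x : ℝ => 1 / (1 + x ^ 2) := by
    simpa only [one_div] using integrable_inv_one_add_sq
  refine (h1.const_mul 8).mono' (Measurable.aestronglyMeasurable (by fun_prop)) ?_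
  refine Eventually.of_forall fun y => ?_
  rw [Real.norm_of_nonneg (div_nonneg (two_sub_two_mul_cos_nonneg y) (sq_nonneg y))]
  rcases eq_or_ne y 0 with rfl | hy
  · simp
  have hy2 : 0 < y ^ 2 := by positivity
  rw [mul_one_div, div_le_div_iff₀ hy2 (by positivity)]
  have h2 := Real.one_sub_sq_div_two_le_cos (x := y)
  have h3 := Real.neg_one_le_cos y
  nlinarith

/-- The normalising constant of the hypersingular integral; it is divided out later, so only its
being nonzero matters. -/
theorem integral_two_sub_two_mul_cos_div_sq_pos :
    0 < ∫ y : ℝ, (2 - 2 * Real.cos y) / y ^ 2 := by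
  rw [integral_pos_iff_support_of_nonneg
    (fun y => div_nonneg (two_sub_two_mul_cos_nonneg y) (sq_nonneg y))
    integrable_two_sub_two_mul_cos_div_sq]
  refine lt_of_lt_of_le ?_ (measure_mono (s := Set.Ioo 1 2) fun y hy => ?_)
  · simp
  · have hcos : Real.cos y < 1 := by
      have := Real.cos_lt_cos_of_nonneg_of_le_pi (x := 0) (y := y) le_rfl
        (by linarith [hy.2, Real.pi_gt_three]) (by linarith [hy.1])
      rwa [Real.cos_zero] at this
    have hy0 : y ≠ 0 := by linarith [hy.1]
    rw [Function.mem_support]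
    exact div_ne_zero (by linarith) (pow_ne_zero 2 hy0)

/-- The scaling y ↦ ηy is what produces the symbol |η|. -/
theorem integral_two_sub_two_mul_cos_mul_div_sq (η : ℝ) :
    ∫ y : ℝ, (2 - 2 * Real.cos (η * y)) / y ^ 2 =
      |η| * ∫ y : ℝ, (2 - 2 * Real.cos y) / y ^ 2 := by
  rcases eq_or_ne η 0 with rfl | hη
  · simp
  have h := Measure.integral_comp_mul_left (fun y : ℝ => (2 - 2 * Real.cos y) / y ^ 2) η
  have h2 : ∀ y : ℝ, (2 - 2 * Real.cos (η * y)) / y ^ 2 =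
      η ^ 2 * ((2 - 2 * Real.cos (η * y)) / (η * y) ^ 2) := by
    intro y
    rw [mul_pow]
    rcases eq_or_ne y 0 with rfl | hy
    · simp
    · field_simp
  simp only [h2]
  rw [integral_const_mul, h, smul_eq_mul, ← mul_assoc]
  congr 1
  rw [abs_inv, ← sq_abs]
  have := abs_pos.2 hη
  field_simp

section SecondDifference

variable {G G' H : ℝ × ℝ → ℂ}

/-- The second difference of `G` in the second variable. -/
noncomputable def secondDifference (G : ℝ × ℝ → ℂ) (x : ℝ × ℝ) (y : ℝ) : ℂ :=
  2 * G x - G (x + (0, y)) - G (x + (0, -y))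

/-- The operator `|∂_t|`, up to a positive constant, as a hypersingular integral. -/
noncomputable def hypersingularIntegral (G : ℝ × ℝ → ℂ) (x : ℝ × ℝ) : ℂ :=
  ∫ y : ℝ, ((1 / y ^ 2 : ℝ) : ℂ) * secondDifference G x y

/-- The y-derivative is -(G'(z,t+y) - G'(z,t-y)), of size at most 2M|y|. This cancels the
singularity of 1/y² at the origin. -/
theorem norm_secondDifference_le {M : ℝ} (hM : ∀ x, ‖H x‖ ≤ M)
    (hG : ∀ z t, HasDerivAt (fun t => G (z, t)) (G' (z, t)) t)
    (hG' : ∀ z t, HasDerivAt (fun t => G' (z, t)) (H (z, t)) t) (x : ℝ × ℝ) (y : ℝ) :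
    ‖secondDifference G x y‖ ≤ 2 * M * y ^ 2 := by
  obtain ⟨z, t⟩ := x
  have hM0 : 0 ≤ M := (norm_nonneg _).trans (hM 0)
  have h1 : ∀ s r : ℝ, ‖G' (z, s) - G' (z, r)‖ ≤ M * |s - r| := by
    intro s r
    have := convex_univ.norm_image_sub_le_of_norm_hasDerivWithin_le
      (fun w _ => (hG' z w).hasDerivWithinAt) (fun w _ => hM (z, w)) (Set.mem_univ r)
      (Set.mem_univ s)
    rwa [Real.norm_eq_abs] at this
  have h2 : ∀ w : ℝ, HasDerivAt (fun y => secondDifference G (z, t) y)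
      (-(G' (z, t + w) - G' (z, t + -w))) w := by
    intro w
    have d1 : HasDerivAt (fun y => G (z, t + y)) (G' (z, t + w)) w := by
      refine ((hG z (t + w)).scomp w ((hasDerivAt_id w).const_add t)).congr_deriv ?_
      simp
    have d2 : HasDerivAt (fun y => G (z, t + -y)) (-G' (z, t + -w)) w := by
      refine ((hG z (t + -w)).scomp w ((hasDerivAt_neg w).const_add t)).congr_deriv ?_
      simp
    have d3 := ((hasDerivAt_const w (2 * G (z, t))).sub d1).sub d2
    simp only [secondDifference, Prod.mk_add_mk, add_zero]
    refine d3.congr_deriv ?_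
    ring
  have h3 := (convex_Icc (-|y|) |y|).norm_image_sub_le_of_norm_hasDerivWithin_le
    (f := fun y => secondDifference G (z, t) y) (C := M * (2 * |y|))
    (fun w _ => (h2 w).hasDerivWithinAt) (fun w hw => ?_)
    (show (0 : ℝ) ∈ Set.Icc (-|y|) |y| from ⟨by simp, abs_nonneg y⟩)
    (show y ∈ Set.Icc (-|y|) |y| from ⟨neg_abs_le y, le_abs_self y⟩)
  · have h4 : secondDifference G (z, t) 0 = 0 := by
      simp only [secondDifference, neg_zero, Prod.mk_add_mk, add_zero]
      ring
    rw [h4, sub_zero, sub_zero, Real.norm_eq_abs] at h3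
    refine h3.trans_eq ?_
    rw [← sq_abs]
    ring
  · rw [norm_neg]
    refine (h1 _ _).trans (mul_le_mul_of_nonneg_left ?_ hM0)
    rw [show t + w - (t + -w) = 2 * w by ring, abs_mul, abs_two]
    exact mul_le_mul_of_nonneg_left (abs_le.2 hw) two_pos.le

theorem norm_secondDifference_le_sup {M : ℝ} (hM : ∀ x, ‖G x‖ ≤ M) (x : ℝ × ℝ) (y : ℝ) :
    ‖secondDifference G x y‖ ≤ 4 * M := by
  have h1 := hM x
  have h2 := hM (x + (0, y))
  have h3 := hM (x + (0, -y))
  have h4 : ‖(2 : ℂ) * G x‖ = 2 * ‖G x‖ := by simp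
  rw [secondDifference]
  refine (norm_sub_le _ _).trans ?_
  have := norm_sub_le (2 * G x) (G (x + (0, y)))
  linarith

/-- Combines quadratic vanishing near 0 with a global bound. It is used both for pointwise values
and for L¹ norms of the second difference. -/
theorem one_div_sq_mul_le {A B N y : ℝ} (hA : 0 ≤ A) (hB : 0 ≤ B) (h1 : |y| ≤ 1 → N ≤ A * y ^ 2)
    (h2 : N ≤ B) : 1 / y ^ 2 * N ≤ 2 * (A + B) * (1 / (1 + y ^ 2)) := by
  rcases eq_or_ne y 0 with rfl | hy
  · simp
    linarith
  have hy2 : 0 < y ^ 2 := by positivity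
  rw [one_div_mul_eq_div, mul_one_div, div_le_div_iff₀ hy2 (by positivity)]
  rcases le_total |y| 1 with h | h
  · have h3 := h1 h
    have h4 : y ^ 2 ≤ 1 := by rwa [sq_le_one_iff_abs_le_one]
    nlinarith [mul_nonneg hA hy2.le, mul_nonneg hB hy2.le]
  · have h4 : 1 ≤ y ^ 2 := by rwa [one_le_sq_iff_one_le_abs]
    nlinarith [mul_nonneg hA hy2.le, mul_nonneg hB hy2.le]

theorem integrable_one_div_one_add_sq : Integrable fun x : ℝ => 1 / (1 + x ^ 2) := by
  simpa only [one_div] using integrable_inv_one_add_sq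

theorem integrable_secondDifference (hG : Integrable G) (y : ℝ) :
    Integrable fun x => secondDifference G x y :=
  ((hG.const_mul 2).sub (hG.comp_add_right (0, y))).sub (hG.comp_add_right (0, -y))

theorem integral_norm_secondDifference_le (hG : Integrable G) (y : ℝ) :
    ∫ x, ‖secondDifference G x y‖ ≤ 4 * ∫ x, ‖G x‖ := by
  have i1 := hG.norm.const_mul 2
  have i2 : Integrable fun x => ‖G (x + (0, y))‖ := (hG.comp_add_right (0, y)).norm
  have i3 : Integrable fun x => ‖G (x + (0, -y))‖ := (hG.comp_add_right (0, -y)).norm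
  have h : ∫ x, ‖secondDifference G x y‖ ≤
      ∫ x, (2 * ‖G x‖ + ‖G (x + (0, y))‖ + ‖G (x + (0, -y))‖) := by
    refine integral_mono (integrable_secondDifference hG y).norm ((i1.add i2).add i3) fun x => ?_
    have h4 : ‖(2 : ℂ) * G x‖ = 2 * ‖G x‖ := by simp
    simp only [secondDifference]
    rw [← h4]
    refine (norm_sub_le _ _).trans (add_le_add (norm_sub_le _ _) le_rfl)
  refine h.trans_eq ?_
  have s1 := integral_add (i1.add i2) i3
  have s2 := integral_add i1 i2
  simp only [Pi.add_apply] at s1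
  rw [s1, s2, integral_const_mul, integral_add_right_eq_self (fun x => ‖G x‖),
    integral_add_right_eq_self (fun x => ‖G x‖)]
  ring

theorem planeFourier_secondDifference (hG : Integrable G) (y : ℝ) (ξ : ℝ × ℝ) :
    planeFourier (fun x => secondDifference G x y) ξ =
      ((2 - 2 * Real.cos (ξ.2 * y) : ℝ) : ℂ) * planeFourier G ξ := by
  have htr : ∀ y : ℝ, planeFourier (fun x => G (x + (0, y))) ξ =
      Complex.exp (Complex.I * ((ξ.2 * y : ℝ) : ℂ)) * planeFourier G ξ := by
    intro y
    have h := integral_add_right_eq_self (μ := (volume : Measure (ℝ × ℝ))) (fun x : ℝ × ℝ =>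
      G x * Complex.exp (-Complex.I * ((x.1 * ξ.1 + x.2 * ξ.2 : ℝ) : ℂ))) (0, y)
    rw [planeFourier, planeFourier, ← h, ← integral_const_mul]
    refine integral_congr_ae (Eventually.of_forall fun x => ?_)
    simp only [Prod.fst_add, Prod.snd_add]
    rw [mul_left_comm, ← Complex.exp_add]
    congr 2
    push_cast
    ring
  have i1 := integrable_mul_exp_neg hG ξ
  have i2 := integrable_mul_exp_neg (hG.comp_add_right (0, y)) ξ
  have i3 := integrable_mul_exp_neg (hG.comp_add_right (0, -y)) ξ
  have hsum : planeFourier (fun x => secondDifference G x y) ξ =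
      2 * planeFourier G ξ - planeFourier (fun x => G (x + (0, y))) ξ -
        planeFourier (fun x => G (x + (0, -y))) ξ := by
    have s1 := integral_sub ((i1.const_mul 2).sub i2) i3
    have s2 := integral_sub (i1.const_mul 2) i2
    simp only [Pi.sub_apply] at s1
    rw [s2, integral_const_mul] at s1
    refine Eq.trans (integral_congr_ae (Eventually.of_forall fun x => ?_)) s1
    simp only [secondDifference]
    ring
  rw [hsum, htr, htr, mul_neg]
  have hcos : (2 - 2 * Real.cos (ξ.2 * y) : ℂ) = 2 - Complex.exp (Complex.I * ((ξ.2 * y : ℝ) : ℂ)) -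
      Complex.exp (Complex.I * ((-(ξ.2 * y) : ℝ) : ℂ)) := by
    have h := Complex.two_cos (((ξ.2 * y : ℝ) : ℂ))
    rw [Complex.ofReal_cos, h]
    push_cast
    rw [mul_comm Complex.I, mul_comm Complex.I]
    ring
  push_cast
  push_cast at hcos
  rw [hcos]
  ring

theorem continuous_hypersingularIntegral
    (hG : Continuous G) (hc : HasCompactSupport G) (hH : Continuous H) (hHc : HasCompactSupport H)
    (hd : ∀ z t, HasDerivAt (fun t => G (z, t)) (G' (z, t)) t)
    (hd' : ∀ z t, HasDerivAt (fun t => G' (z, t)) (H (z, t)) t) : Continuous (hypersingularIntegral G) := by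
  obtain ⟨M, hM⟩ := hH.bounded_above_of_compact_support hHc
  obtain ⟨N, hN⟩ := hG.bounded_above_of_compact_support hc
  have hM0 : 0 ≤ M := (norm_nonneg _).trans (hM 0)
  have hN0 : 0 ≤ N := (norm_nonneg _).trans (hN 0)
  refine continuous_of_dominated (bound := fun y => 2 * (2 * M + 4 * N) * (1 / (1 + y ^ 2))) ?_ ?_
    (integrable_one_div_one_add_sq.const_mul _) ?_
  · intro x
    refine (Measurable.mul (by fun_prop) (Continuous.measurable ?_)).aestronglyMeasurable
    unfold secondDifference
    fun_prop
  · intro x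
    refine Eventually.of_forall fun y => ?_
    rw [norm_mul, Complex.norm_real, Real.norm_of_nonneg (by positivity)]
    exact one_div_sq_mul_le (by positivity) (by positivity)
      (fun _ => norm_secondDifference_le hM hd hd' x y) (norm_secondDifference_le_sup hN x y)
  · refine Eventually.of_forall fun y => ?_
    unfold secondDifference
    fun_prop

/-- Tonelli with x integrated first. For |y| ≤ 1 the second difference lives on a fixed compact set,
so its L¹ norm is O(y²); for every y it is at most 4‖G‖₁. -/
theorem integrable_one_div_sq_mul_secondDifference
    (hG : Continuous G) (hc : HasCompactSupport G) (hH : Continuous H) (hHc : HasCompactSupport H)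
    (hd : ∀ z t, HasDerivAt (fun t => G (z, t)) (G' (z, t)) t)
    (hd' : ∀ z t, HasDerivAt (fun t => G' (z, t)) (H (z, t)) t) :
    Integrable (Function.uncurry fun (x : ℝ × ℝ) (y : ℝ) =>
      ((1 / y ^ 2 : ℝ) : ℂ) * secondDifference G x y)
      ((volume : Measure (ℝ × ℝ)).prod (volume : Measure ℝ)) := by
  obtain ⟨M, hM⟩ := hH.bounded_above_of_compact_support hHc
  have hM0 : 0 ≤ M := (norm_nonneg _).trans (hM 0)
  have hGi : Integrable G := hG.integrable_of_hasCompactSupport hc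
  obtain ⟨L, hL0, hL⟩ := exists_support_bound hc
  set S : Set (ℝ × ℝ) := Set.Icc (-(L + 1)) (L + 1) ×ˢ Set.Icc (-(L + 1)) (L + 1) with hS
  have hSc : IsCompact S := isCompact_Icc.prod isCompact_Icc
  have hzero : ∀ y : ℝ, |y| ≤ 1 → ∀ x ∉ S, secondDifference G x y = 0 := by
    intro y hy x hx
    have hG0 : ∀ w : ℝ, |w| ≤ 1 → G (x + (0, w)) = 0 := by
      intro w hw
      by_contra hne
      obtain ⟨h1, h2⟩ := hL _ hne
      simp only [Prod.fst_add, Prod.snd_add, add_zero] at h1 h2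
      rw [abs_lt] at h1 h2
      rw [abs_le] at hw
      exact hx ⟨⟨by linarith [h1.1], by linarith [h1.2]⟩,
        ⟨by linarith [h2.1], by linarith [h2.2]⟩⟩
    have h0 := hG0 0 (by simp)
    rw [show ((0 : ℝ), (0 : ℝ)) = 0 from rfl, add_zero] at h0
    rw [secondDifference, h0, hG0 y hy, hG0 (-y) (by rwa [abs_neg])]
    ring
  have hmeas : Measurable (Function.uncurry fun (x : ℝ × ℝ) (y : ℝ) =>
      ((1 / y ^ 2 : ℝ) : ℂ) * secondDifference G x y) := by
    refine Measurable.mul (by fun_prop) (Continuous.measurable ?_)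
    simp only [secondDifference]
    fun_prop
  rw [integrable_prod_iff' hmeas.aestronglyMeasurable]
  refine ⟨Eventually.of_forall fun y => by
    simpa only [Function.uncurry] using (integrable_secondDifference hGi y).const_mul _, ?_⟩
  refine (integrable_one_div_one_add_sq.const_mul
    (2 * (2 * M * volume.real S + 4 * ∫ x, ‖G x‖))).mono' ?_ ?_
  · exact hmeas.norm.stronglyMeasurable.integral_prod_left'.aestronglyMeasurable
  · refine Eventually.of_forall fun y => ?_
    simp only [Function.uncurry]
    rw [Real.norm_of_nonneg (integral_nonneg fun _ => norm_nonneg _)]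
    have hN : ∫ x, ‖((1 / y ^ 2 : ℝ) : ℂ) * secondDifference G x y‖ =
        1 / y ^ 2 * ∫ x, ‖secondDifference G x y‖ := by
      rw [← integral_const_mul]
      refine integral_congr_ae (Eventually.of_forall fun x => ?_)
      simp only
      rw [norm_mul, Complex.norm_real, Real.norm_of_nonneg (by positivity)]
    rw [hN]
    refine one_div_sq_mul_le (by positivity) (by positivity) (fun hy => ?_)
      (integral_norm_secondDifference_le hGi y)
    rw [← setIntegral_eq_integral_of_forall_compl_eq_zero (s := S)
      (fun x hx => by rw [hzero y hy x hx, norm_zero])]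
    have h1 := norm_setIntegral_le_of_norm_le_const (μ := volume) (s := S)
      (f := fun x => ‖secondDifference G x y‖) (C := 2 * M * y ^ 2) hSc.measure_lt_top
      (fun x _ => by
        rw [norm_norm]
        exact norm_secondDifference_le hM hd hd' x y)
    refine (le_abs_self _).trans (h1.trans_eq ?_)
    ring

theorem integrable_hypersingularIntegral
    (hG : Continuous G) (hc : HasCompactSupport G) (hH : Continuous H) (hHc : HasCompactSupport H)
    (hd : ∀ z t, HasDerivAt (fun t => G (z, t)) (G' (z, t)) t)
    (hd' : ∀ z t, HasDerivAt (fun t => G' (z, t)) (H (z, t)) t) : Integrable (hypersingularIntegral G) :=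
  (integrable_one_div_sq_mul_secondDifference hG hc hH hHc hd hd').integral_prod_left

/-- Under Fubini a second difference by y becomes the factor 2 - 2cos(ξ₂y), whose integral against
1/y² is a multiple of |ξ₂|. -/
theorem planeFourier_hypersingularIntegral
    (hG : Continuous G) (hc : HasCompactSupport G) (hH : Continuous H) (hHc : HasCompactSupport H)
    (hd : ∀ z t, HasDerivAt (fun t => G (z, t)) (G' (z, t)) t)
    (hd' : ∀ z t, HasDerivAt (fun t => G' (z, t)) (H (z, t)) t)
    (ξ : ℝ × ℝ) :
    planeFourier (hypersingularIntegral G) ξ =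
      ((|ξ.2| * ∫ y : ℝ, (2 - 2 * Real.cos y) / y ^ 2 : ℝ) : ℂ) * planeFourier G ξ := by
  have hGi : Integrable G := hG.integrable_of_hasCompactSupport hc
  have hint : Integrable (Function.uncurry fun (x : ℝ × ℝ) (y : ℝ) =>
      ((1 / y ^ 2 : ℝ) : ℂ) * secondDifference G x y *
        Complex.exp (-Complex.I * ((x.1 * ξ.1 + x.2 * ξ.2 : ℝ) : ℂ)))
      ((volume : Measure (ℝ × ℝ)).prod (volume : Measure ℝ)) := by
    refine (integrable_one_div_sq_mul_secondDifference hG hc hH hHc hd hd').mul_bdd (c := 1) ?_ ?_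
    · exact Continuous.aestronglyMeasurable (by fun_prop)
    · exact Eventually.of_forall fun y => (norm_exp_neg_I_mul_ofReal _).le
  rw [planeFourier]
  simp only [hypersingularIntegral, ← integral_mul_const]
  rw [integral_integral_swap hint, ← integral_two_sub_two_mul_cos_mul_div_sq,
    ← integral_complex_ofReal, ← integral_mul_const]
  refine integral_congr_ae (Eventually.of_forall fun y => ?_)
  simp only [mul_assoc]
  rw [integral_const_mul]
  have h := planeFourier_secondDifference hGi y ξ
  rw [planeFourier] at h
  rw [h]
  push_cast
  ring

end SecondDifference

/-! ### The absolutely convergent case and the conclusion -/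

/-- If all back-projection integrals converge absolutely, then the back-projection is continuous,
integrable and inverted by the Fourier multiplier `|ξ₂|`. -/
theorem backProjection_axisMean_of_integrable {H : ℝ × ℝ → ℂ} (hH : ContDiff ℝ ∞ H)
    (hc : HasCompactSupport H) (heven : ∀ z t, H (z, -t) = H (z, t))
    (hint : ∀ x, Integrable fun p => axisMean H p x) :
    Integrable (fun x => ∫ p, axisMean H p x) ∧
      ∀ ξ, ((|ξ.2| : ℝ) : ℂ) * planeFourier (fun x => ∫ p, axisMean H p x) ξ = planeFourier H ξ := by
  obtain ⟨G, G', hG, hGc, hG', hGc', hd, hd'⟩ := exists_second_primitive_snd hH hc heven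
    fun z => integral_eq_zero_of_integrable_axisMean hH.continuous hc (hint (z, 0))
  set E := planeFourier H with hE
  set e := planeFourier (-G) with he
  have hneg : ∀ ξ, e ξ = -planeFourier G ξ := by
    intro ξ
    rw [he, planeFourier, planeFourier, ← integral_neg]
    simp only [Pi.neg_apply, neg_mul]
  have hEe : ∀ ξ, E ξ = (ξ.2 : ℂ) ^ 2 * e ξ := by
    intro ξ
    rw [hneg, hE, planeFourier_of_hasDerivAt_snd hG' hGc' hd', planeFourier_of_hasDerivAt_snd hG hGc hd]
    linear_combination (ξ.2 : ℂ) ^ 2 * planeFourier G ξ * Complex.I_sq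
  have hHi := hH.continuous.integrable_of_hasCompactSupport (μ := volume) hc
  have hEc : Continuous E := continuous_planeFourier hHi
  have hEeven : ∀ s y, planeFourier H (s, -y) = planeFourier H (s, y) := planeFourier_even heven
  obtain ⟨CH, hCH⟩ := exists_circleDecay_planeFourier hH hc
  obtain ⟨C, hC⟩ := exists_circleDecay_planeFourier hG.neg hGc.neg
  obtain ⟨⟨K, hK⟩, hlim⟩ := hC.circleTransform_of_sq_mul hEc hEe
  set κ := ∫ y : ℝ, (2 - 2 * Real.cos y) / y ^ 2
  have hκ : (κ : ℂ) ≠ 0 := by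
    exact_mod_cast integral_two_sub_two_mul_cos_div_sq_pos.ne'
  -- The inverse transform of |ξ₂|e. As |ξ₂|e need not be smooth at ξ₂ = 0, integrability of h₀ is
  -- read off from the hypersingular form and not from the frequency side.
  set h₀ : ℝ × ℝ → ℂ := fun x => -(κ : ℂ)⁻¹ * hypersingularIntegral G x with hh₀
  have h₀i : Integrable h₀ := (integrable_hypersingularIntegral hG.continuous hGc hH.continuous hc
    hd hd').const_mul _
  have h₀c : Continuous h₀ := continuous_const.mul
    (continuous_hypersingularIntegral hG.continuous hGc hH.continuous hc hd hd')
  have h₀F : ∀ ξ, planeFourier h₀ ξ = ((|ξ.2| : ℝ) : ℂ) * e ξ := by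
    intro ξ
    have h1 : planeFourier h₀ ξ = -(κ : ℂ)⁻¹ * planeFourier (hypersingularIntegral G) ξ := by
      rw [planeFourier, planeFourier, ← integral_const_mul]
      simp only [hh₀, mul_assoc]
    rw [h1, planeFourier_hypersingularIntegral hG.continuous hGc hH.continuous hc hd hd', hneg,
      show ∫ y : ℝ, (2 - 2 * Real.cos y) / y ^ 2 = κ from rfl, Complex.ofReal_mul]
    field_simp
  have h₀Fi : Integrable (planeFourier h₀) := by
    rw [show planeFourier h₀ = fun ξ => ((|ξ.2| : ℝ) : ℂ) * e ξ from funext h₀F]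
    exact integrable_abs_mul_of_bracket_bound hC.continuous hC.bound
  -- The truncated back-projections at x have two limits: the full integral, by absolute
  -- convergence, and h₀(x), by dominated convergence in frequency. Continuity of h₀ makes the
  -- inversion valid at every x.
  have hkey : (fun x => ∫ p, axisMean H p x) = h₀ := by
    funext x
    have hl1 : Tendsto (fun ab : ℝ × ℝ => axisBackProjection ab.1 ab.2 H x) (atTop ×ˢ atTop)
        (𝓝 (∫ p, axisMean H p x)) :=
      (aecover_Icc (tendsto_neg_atTop_atBot.comp tendsto_fst)
        tendsto_snd).integral_tendsto_of_countably_generated (hint x)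
    have hl2 : Tendsto (fun ab : ℝ × ℝ => axisBackProjection ab.1 ab.2 H x) (atTop ×ˢ atTop)
        (𝓝 (h₀ x)) := by
      rw [← planeFourier_inversion h₀c h₀i h₀Fi x]
      have hinv : ∀ ab : ℝ × ℝ, (1 / (4 * (Real.pi : ℂ) ^ 2)) * ∫ ξ : ℝ × ℝ,
          planeFourier (axisBackProjection ab.1 ab.2 H) ξ *
            Complex.exp (Complex.I * ((x.1 * ξ.1 + x.2 * ξ.2 : ℝ) : ℂ)) =
          axisBackProjection ab.1 ab.2 H x := by
        intro ab
        have hi := integrable_axisBackProjection hH.continuous hc ab.1 ab.2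
        obtain ⟨B, hB0, hB⟩ := planeFourier_axisBackProjection_bound hH.continuous hc hCH ab.1 ab.2
        refine planeFourier_inversion ?_ hi
          (integrable_of_bracket_bound (continuous_planeFourier hi) hB0 hB) x
        exact continuous_parametric_integral_of_continuous (f := fun x p => axisMean H p x)
          ((continuous_axisMean hH.continuous).comp continuous_swap) isCompact_Icc
      refine Tendsto.congr hinv (Tendsto.const_mul _ ?_)
      refine tendsto_integral_filter_of_dominated_convergence
        (fun ξ => ‖1 / (2 * (Real.pi : ℂ))‖ * (K * frequencyMajorant ξ)) ?_ ?_
        ((integrable_frequencyMajorant.const_mul K).const_mul _) ?_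
      · refine Eventually.of_forall fun ab => Continuous.aestronglyMeasurable ?_
        have := continuous_planeFourier (integrable_axisBackProjection hH.continuous hc ab.1 ab.2)
        fun_prop
      · refine Eventually.of_forall fun ab => ?_
        filter_upwards [ae_snd_ne_zero] with ξ hξ
        rw [norm_mul, norm_exp_I_mul_ofReal, mul_one,
          planeFourier_axisBackProjection_eq_circleTransform hH.continuous hc hEeven _ _ hξ,
          norm_mul]
        exact mul_le_mul_of_nonneg_left (hK ξ hξ ab.1 ab.2) (norm_nonneg _)
      · filter_upwards [ae_snd_ne_zero] with ξ hξ
        refine Tendsto.mul_const _ ?_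
        -- Evenness of e is inherited from Ĥ on dividing by ξ₂² ≠ 0.
        have heE : e (ξ.1, |ξ.2|) = e ξ := by
          have h1 : E (ξ.1, |ξ.2|) = E ξ := by
            rcases abs_choice ξ.2 with h | h <;> rw [h]
            exact hEeven ξ.1 ξ.2
          rw [hEe, hEe] at h1
          have h2 : (((|ξ.2| : ℝ) : ℂ)) ^ 2 = (ξ.2 : ℂ) ^ 2 := by
            rw [← Complex.ofReal_pow, sq_abs, Complex.ofReal_pow]
          simp only [h2] at h1
          exact mul_left_cancel₀ (pow_ne_zero 2 (by exact_mod_cast hξ)) h1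
        have hval : planeFourier h₀ ξ = (1 / (2 * (Real.pi : ℂ))) *
            (2 * Real.pi * (((|ξ.2| : ℝ) : ℂ) * e (ξ.1, |ξ.2|))) := by
          have : (Real.pi : ℂ) ≠ 0 := by exact_mod_cast Real.pi_ne_zero
          rw [heE, h₀F]
          field_simp
        rw [hval]
        refine ((hlim ξ hξ).const_mul (1 / (2 * (Real.pi : ℂ)))).congr fun ab => ?_
        rw [planeFourier_axisBackProjection_eq_circleTransform hH.continuous hc hEeven _ _ hξ]
    exact tendsto_nhds_unique hl1 hl2
  rw [hkey]
  refine ⟨h₀i, fun ξ => ?_⟩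
  rw [h₀F, hEe, ← mul_assoc, ← Complex.ofReal_mul, abs_mul_abs_self]
  push_cast
  ring

theorem filteredBackProjection_of_integrable (u : ℝ) {f : EuclideanSpace ℝ (Fin 3) → ℂ}
    (hf : ContDiff ℝ ∞ f) (hfc : HasCompactSupport f) (μ : EuclideanSpace ℝ (Fin 2))
    (hint : ∀ z ρ : ℝ,
      Integrable fun p : ℝ => toroidalRadon u f μ p (√((z - p) ^ 2 + ρ ^ 2))) :
    FilteredBackProjectionConverges (toroidalRadon u f) μ ∧
      ∀ z ρ, rieszTwoInv (backProjection (toroidalRadon u f)) μ z ρ =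
        toroidalSlice u f μ (z, ρ) := by
  set H := toroidalSlice u f μ
  have hH : ContDiff ℝ ∞ H := contDiff_toroidalSlice u μ hf
  have hc : HasCompactSupport H := hasCompactSupport_toroidalSlice u μ hfc
  have hback : (fun x : ℝ × ℝ => backProjection (toroidalRadon u f) μ x.1 x.2) =
      fun x => ∫ p, axisMean H p x := by
    funext x
    simp only [backProjection, toroidalRadon_sqrt_eq_axisMean u μ hf.continuous]
    rfl
  obtain ⟨hi, hF⟩ := backProjection_axisMean_of_integrable hH hc (toroidalSlice_neg u μ f)
    fun x => by
      have h := hint x.1 x.2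
      simp only [toroidalRadon_sqrt_eq_axisMean u μ hf.continuous] at h
      exact h
  have hmul : ∀ ξ : ℝ × ℝ, ((|ξ.2| : ℝ) : ℂ) *
      fourierLastTwo (backProjection (toroidalRadon u f)) μ ξ = planeFourier H ξ := by
    intro ξ
    rw [fourierLastTwo_eq_planeFourier, hback, hF]
  obtain ⟨C, hC⟩ := exists_circleDecay_planeFourier hH hc
  have hEi : Integrable (planeFourier H) :=
    integrable_of_bracket_bound hC.continuous hC.nonneg hC.bound
  refine ⟨⟨hint, ?_, ?_⟩, fun z ρ => ?_⟩
  · rw [hback]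
    exact hi
  · simp only [hmul]
    exact hEi
  · simp only [rieszTwoInv, hmul]
    exact planeFourier_inversion hH.continuous
      (hH.continuous.integrable_of_hasCompactSupport hc) hEi (z, ρ)

theorem mainTheorem7 (u : ℝ) (hu : 0 < u) (f : EuclideanSpace ℝ (Fin 3) → ℂ)
    (hf : ContDiff ℝ ∞ f) (hfc : HasCompactSupport f) (μ : EuclideanSpace ℝ (Fin 2)) :
    (∀ a b : ℝ,
      FilteredBackProjectionConverges (truncateHeight a b (toroidalRadon u f)) μ) ∧
    (∀ x₃ r : ℝ, 0 ≤ r →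
      Tendsto
        (fun ab : ℝ × ℝ =>
          rieszTwoInv (backProjection (truncateHeight ab.1 ab.2 (toroidalRadon u f))) μ x₃ r)
        (atTop ×ˢ atTop)
        (𝓝 (circularRadon f μ x₃ |u - r| + circularRadon f μ x₃ (u + r)))) ∧
    ((∀ z ρ : ℝ,
        Integrable (fun p : ℝ => toroidalRadon u f μ p (Real.sqrt ((z - p) ^ 2 + ρ ^ 2)))) →
      FilteredBackProjectionConverges (toroidalRadon u f) μ ∧
      ∀ x₃ r : ℝ, 0 ≤ r →
        rieszTwoInv (backProjection (toroidalRadon u f)) μ x₃ r =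
          circularRadon f μ x₃ |u - r| + circularRadon f μ x₃ (u + r)) := by
  refine ⟨filteredBackProjectionConverges_truncateHeight u μ hf hfc, fun x₃ r _ => ?_,
    fun hint => ?_⟩
  · rw [← toroidalSlice_eq]
    exact tendsto_rieszTwoInv_truncateHeight u μ hf hfc x₃ r
  · obtain ⟨h1, h2⟩ := filteredBackProjection_of_integrable u hf hfc μ hint
    exact ⟨h1, fun x₃ r _ => (h2 x₃ r).trans (toroidalSlice_eq u μ f x₃ r)⟩
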